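/- All graphs are finite, simple and undirected. Let $G=(V,E)$ be a connected graph with $n$ vertices, $m$ edges and non-negative real vertex weights $w$, and write $w(V)=\sum_{v\in V}w(v)$. $G$ is claw-free if it has no induced subgraph isomorphic to $K_{1,3}$. For a spanning tree $T$ of $G$ let $w_{\mathrm{int}}(T)$ be the total weight of the vertices of degree at least $2$ in $T$ (the internal vertices); the maximum weight internal spanning tree problem (MaxwIST) asks for a spanning tree $T$ that maximizes $w_{\mathrm{int}}(T)$. A greedy DFS tree is the rooted tree built by a depth-first search that always moves from the current vertex to a non-visited neighbour of maximum weight (ties broken arbitrarily) and backtracks if there is none. Algorithms run on a unit-cost random access machine that receives $n$, the adjacency lists of $G$ (in arbitrary order) and the weights; on indices it can do successor, predecessor, comparison and indirect addressing, and on weights (real numbers) addition, subtraction and comparison. The output is a list of the edges of a spanning tree of $G$. 1. If $G$ is connected and claw-free with minimum degree at least $3$ and $r$ is a vertex of minimum weight, then greedy DFS trees of $G$ with root $r$ exist and every such tree is binary, i.e. each of its nodes has at most two children. 2. There is an algorithm that, for every connected vertex-weighted claw-free graph $G$ with minimum degree at least $3$, computes in $O(n+m)$ time a spanning tree $T$ of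 $G$ with $w_{\mathrm{int}}(T)\ge\left(\frac35-\frac1n\right)w(V)$. 3. For every $\varepsilon>0$ there is an algorithm that, for every connected vertex-weighted claw-free graph $G$ without vertices of degree $2$ (vertices of degree $1$ are allowed), computes in $O(n+m)$ time, with a constant depending only on $\varepsilon$, a spanning tree $T$ of $G$ with $w_{\mathrm{int}}(T)\ge\left(\frac35-\varepsilon\right)w_{\mathrm{int}}(S)$ for every spanning tree $S$ of $G$. That is, MaxwIST in claw-free graphs without degree-2 vertices has a linear-time $\left(\frac35-\varepsilon\right)$-approximation algorithm. -/

import Mathlib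

namespace MaxwIST

/-! ### Graphs, spanning trees, internal weight -/

/-- `G` has no induced subgraph isomorphic to `K_{1,3}`. -/
def ClawFree {V : Type*} (G : SimpleGraph V) : Prop :=
  ¬ (completeBipartiteGraph (Fin 1) (Fin 3)).IsIndContained G

/-- `T` is a spanning tree of `G` (it lives on the same vertex set). -/
def IsSpanningTree {V : Type*} (G T : SimpleGraph V) : Prop :=
  T ≤ G ∧ T.IsTree

open Classical in
/-- Total weight of the internal vertices (those of degree at least two) of `T`. -/
noncomputable def internalWeight {n : ℕ} (T : SimpleGraph (Fin n)) (w : Fin n → ℝ) : ℝ :=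
  ∑ v with 2 ≤ T.degree v, w v

/-! ### Greedy depth-first search -/

/-- The configurations that greedy depth-first search started at `r` can reach. A configuration
consists of the stack (the path from the current vertex up to the root), the set of visited
vertices, and the set of pairs (parent, child) built so far. The search moves from the current
vertex to a non-visited neighbour of maximum weight, and backtracks if there is none. -/
inductive GreedyDFS {V : Type*} (G : SimpleGraph V) (w : V → ℝ) (r : V) :
    List V → Set V → Set (V × V) → Prop
  | start : GreedyDFS G w r [r] {r} ∅
  | advance {x y : V} {s : List V} {vis : Set V} {E : Set (V × V)} :
      GreedyDFS G w r (x :: s) vis E → G.Adj x y → y ∉ vis →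
      (∀ z, G.Adj x z → z ∉ vis → w z ≤ w y) →
      GreedyDFS G w r (y :: x :: s) (insert y vis) (insert (x, y) E)
  | backtrack {x : V} {s : List V} {vis : Set V} {E : Set (V × V)} :
      GreedyDFS G w r (x :: s) vis E → (∀ z, G.Adj x z → z ∈ vis) →
      GreedyDFS G w r s vis E

/-- `E` is the set of (parent, child) pairs of a greedy DFS tree with root `r`: it is what a
completed search has built. Ties between vertices of equal weight may be broken in any way. -/
def IsGreedyDFSTree {V : Type*} (G : SimpleGraph V) (w : V → ℝ) (r : V) (E : Set (V × V)) : Prop :=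
  ∃ vis, GreedyDFS G w r [] vis E

/-- Every node has at most two children. -/
def IsBinary {V : Type*} (E : Set (V × V)) : Prop :=
  ∀ x, {y | (x, y) ∈ E}.encard ≤ 2

/-! ### The machine model

A random access machine with a memory for natural numbers (indices) and a memory for real numbers
(weights). Each of the two has registers and arrays, which a program addresses by fixed names, so
that it uses finitely many of them; array cells are addressed by computed indices. The index
arithmetic is only successor and predecessor, so an index never exceeds the largest number in the
input and the program by more than the number of steps made. Weights can be copied, added,
subtracted and compared, and are never converted to indices. -/

structure Mem where
  /-- index registers -/
  ireg : ℕ → ℕ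
  /-- index arrays -/
  iarr : ℕ → ℕ → ℕ
  /-- weight registers -/
  wreg : ℕ → ℝ
  /-- weight arrays -/
  warr : ℕ → ℕ → ℝ

inductive IExp where
  | const (k : ℕ)
  | reg (x : ℕ)
  | arr (a : ℕ) (i : IExp)
  | succ (e : IExp)
  | pred (e : IExp)

def IExp.eval (σ : Mem) : IExp → ℕ
  | .const k => k
  | .reg x => σ.ireg x
  | .arr a i => σ.iarr a (i.eval σ)
  | .succ e => e.eval σ + 1
  | .pred e => e.eval σ - 1

/-- Number of steps needed to evaluate the expression: one per operation. -/
def IExp.cost : IExp → ℕ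
  | .const _ => 1
  | .reg _ => 1
  | .arr _ i => i.cost + 1
  | .succ e => e.cost + 1
  | .pred e => e.cost + 1

inductive WExp where
  | zero
  | reg (x : ℕ)
  | arr (a : ℕ) (i : IExp)
  | add (e f : WExp)
  | sub (e f : WExp)

noncomputable def WExp.eval (σ : Mem) : WExp → ℝ
  | .zero => 0
  | .reg x => σ.wreg x
  | .arr a i => σ.warr a (i.eval σ)
  | .add e f => e.eval σ + f.eval σ
  | .sub e f => e.eval σ - f.eval σ

def WExp.cost : WExp → ℕ
  | .zero => 1
  | .reg _ => 1
  | .arr _ i => i.cost + 1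
  | .add e f => e.cost + f.cost + 1
  | .sub e f => e.cost + f.cost + 1

inductive Test where
  | ieq (e f : IExp)
  | ilt (e f : IExp)
  | wlt (e f : WExp)
  | neg (t : Test)
  | conj (t u : Test)

def Test.Holds (σ : Mem) : Test → Prop
  | .ieq e f => e.eval σ = f.eval σ
  | .ilt e f => e.eval σ < f.eval σ
  | .wlt e f => e.eval σ < f.eval σ
  | .neg t => ¬ t.Holds σ
  | .conj t u => t.Holds σ ∧ u.Holds σ

def Test.cost : Test → ℕ
  | .ieq e f => e.cost + f.cost + 1
  | .ilt e f => e.cost + f.cost + 1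
  | .wlt e f => e.cost + f.cost + 1
  | .neg t => t.cost + 1
  | .conj t u => t.cost + u.cost + 1

inductive Program where
  | skip
  /-- index register `x` := `e` -/
  | iset (x : ℕ) (e : IExp)
  /-- index array cell `a[i]` := `e` -/
  | istore (a : ℕ) (i e : IExp)
  /-- weight register `x` := `e` -/
  | wset (x : ℕ) (e : WExp)
  /-- weight array cell `a[i]` := `e` -/
  | wstore (a : ℕ) (i : IExp) (e : WExp)
  | seq (p q : Program)
  | cond (t : Test) (p q : Program)
  | loop (t : Test) (p : Program)

def Mem.iset (σ : Mem) (x k : ℕ) : Mem :=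
  { σ with ireg := Function.update σ.ireg x k }

def Mem.istore (σ : Mem) (a i k : ℕ) : Mem :=
  { σ with iarr := Function.update σ.iarr a (Function.update (σ.iarr a) i k) }

noncomputable def Mem.wset (σ : Mem) (x : ℕ) (q : ℝ) : Mem :=
  { σ with wreg := Function.update σ.wreg x q }

noncomputable def Mem.wstore (σ : Mem) (a i : ℕ) (q : ℝ) : Mem :=
  { σ with warr := Function.update σ.warr a (Function.update (σ.warr a) i q) }

/-- `Exec p σ τ t`: started in memory `σ`, the program `p` halts in memory `τ` after exactly `t`
steps. (The semantics is deterministic; a run that does not halt has no such `τ` and `t`.) -/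
inductive Exec : Program → Mem → Mem → ℕ → Prop
  | skip (σ : Mem) : Exec .skip σ σ 1
  | iset (σ : Mem) (x : ℕ) (e : IExp) :
      Exec (.iset x e) σ (σ.iset x (e.eval σ)) (e.cost + 1)
  | istore (σ : Mem) (a : ℕ) (i e : IExp) :
      Exec (.istore a i e) σ (σ.istore a (i.eval σ) (e.eval σ)) (i.cost + e.cost + 1)
  | wset (σ : Mem) (x : ℕ) (e : WExp) :
      Exec (.wset x e) σ (σ.wset x (e.eval σ)) (e.cost + 1)
  | wstore (σ : Mem) (a : ℕ) (i : IExp) (e : WExp) :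
      Exec (.wstore a i e) σ (σ.wstore a (i.eval σ) (e.eval σ)) (i.cost + e.cost + 1)
  | seq {p q : Program} {σ τ υ : Mem} {s t : ℕ} :
      Exec p σ τ s → Exec q τ υ t → Exec (.seq p q) σ υ (s + t)
  | condTrue {b : Test} {p q : Program} {σ τ : Mem} {t : ℕ} :
      b.Holds σ → Exec p σ τ t → Exec (.cond b p q) σ τ (b.cost + t)
  | condFalse {b : Test} {p q : Program} {σ τ : Mem} {t : ℕ} :
      ¬ b.Holds σ → Exec q σ τ t → Exec (.cond b p q) σ τ (b.cost + t)
  | loopTrue {b : Test} {p : Program} {σ τ υ : Mem} {s t : ℕ} :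
      b.Holds σ → Exec p σ τ s → Exec (.loop b p) τ υ t → Exec (.loop b p) σ υ (b.cost + s + t)
  | loopFalse {b : Test} {p : Program} {σ : Mem} :
      ¬ b.Holds σ → Exec (.loop b p) σ σ b.cost

/-! ### Input and output -/

/-- The arrays `off` and `adj` store adjacency lists of `G`: the neighbours of `v` are
`adj[off[v]], …, adj[off[v+1] - 1]`, without repetition and in an arbitrary order. -/
structure IsAdjacencyArray {n : ℕ} (G : SimpleGraph (Fin n)) (off adj : ℕ → ℕ) : Prop where
  off_zero : off 0 = 0
  off_le : ∀ v : Fin n, off v ≤ off (v + 1)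
  adj_lt : ∀ i < off n, adj i < n
  adj_iff : ∀ u v : Fin n, G.Adj u v ↔ ∃ i, off u ≤ i ∧ i < off (u + 1) ∧ adj i = v
  adj_inj : ∀ v : Fin n, Set.InjOn adj (Set.Ico (off v) (off (v + 1)))

/-- The initial memory: the number of vertices is in index register `0`, the adjacency lists are
in the index arrays `0` and `1` (whose cells beyond the lists may hold anything), the vertex
weights are in the weight array `0`; everything else is `0`. -/
noncomputable def inputMem {n : ℕ} (off adj : ℕ → ℕ) (w : Fin n → ℝ) : Mem where
  ireg x := if x = 0 then n else 0
  iarr a := if a = 0 then off else if a = 1 then adj else fun _ => 0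
  wreg _ := 0
  warr a i := if h : a = 0 ∧ i < n then w ⟨i, h.2⟩ else 0

/-- The memory `σ` holds the graph `T` as an edge list: with `k` the content of index register
`1`, the edges of `T` are the pairs of entries at the positions `i < k` of the index arrays `2`
and `3`, and each edge is listed exactly once. -/
structure HoldsEdgeList {n : ℕ} (σ : Mem) (T : SimpleGraph (Fin n)) : Prop where
  sound : ∀ i < σ.ireg 1, ∃ u v : Fin n, T.Adj u v ∧ σ.iarr 2 i = u ∧ σ.iarr 3 i = v
  complete : ∀ u v : Fin n, T.Adj u v →
    ∃! i, i < σ.ireg 1 ∧ s(σ.iarr 2 i, σ.iarr 3 i) = s((u : ℕ), (v : ℕ))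

/-- On the vertex-weighted graph `(G, w)`, in whatever order the adjacency lists are given, the
program `p` halts after at most `bound` steps and outputs a spanning tree `T` of `G` that
satisfies `Good T`. -/
def OutputsSpanningTree (p : Program) (bound : ℕ) {n : ℕ} (G : SimpleGraph (Fin n))
    (w : Fin n → ℝ) (Good : SimpleGraph (Fin n) → Prop) : Prop :=
  ∀ off adj : ℕ → ℕ, IsAdjacencyArray G off adj →
    ∃ (σ : Mem) (t : ℕ) (T : SimpleGraph (Fin n)),
      Exec p (inputMem off adj w) σ t ∧ t ≤ bound ∧
      HoldsEdgeList σ T ∧ IsSpanningTree G T ∧ Good T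

end MaxwIST

namespace MaxwIST

/-! ### Trees given by a parent function -/

/-! Depth-first search leaves every edge of the graph between an ancestor and a descendant, so
siblings are non-adjacent and a node with three children would be the centre of a claw
(`SearchInv.isBinary`). Leaves are pairwise non-adjacent too, so no vertex is adjacent to three of
them (`SearchTree.three_leaves`). The greedy rule contributes this: if a leaf `l` below `c` is
adjacent to `par c`, then `l` was available when `c` was chosen, so `w l ≤ w c`
(`SearchTree.weight_le`). Every neighbour of `l` other than its parent thus yields a guard that can
pay for `l`, and a vertex guards at most two leaves.

The ratio 3/5 follows if each leaf charges one internal vertex that no other leaf charges and a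
second one shared with at most one other leaf: then `3 w(F) ≤ 2 w(I)` for the leaves `F` and the
internal vertices `I` (`sum_le_of_charges`). Two leaves may share a guard, but if they share a
neighbour other than the root, claw-freeness makes one of them adjacent to the next vertex up as
well (`SearchTree.adj_grandparent`). That leaf spans a triangle with a tree edge and can be inserted
into this edge, which makes it internal. Insertion uses the top edge of a run of such triangles, and
happens only if the old parent retains a child not yet inserted or weighs less than the leaf. The
leaves of the resulting tree fall into the four cases of `Charge`; `Inserted.exists_charge` and
`Charge.disjoint` show that the charges exist and do not collide, which gives
`Inserted.internal_weight`.

Vertices of degree one are never internal, so they get weight 0 and need no charge; the others have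
degree at least three, hence two neighbours besides the parent. Omitting a root of minimum weight
costs at most the average weight. Against another spanning tree it costs nothing, since that tree
has a leaf at least as heavy in inner weight (`internalWeight_le`). The approximation ratio reached
is therefore 3/5 itself, and one program serves every `ε`.

Since nodes have at most two children, each vertex is current at most three times during the search,
so rescanning its whole adjacency list at each visit is affordable; a potential function makes this
precise. The leaf phase scans the list of each leaf twice. -/

/-- The graph whose edges join each vertex other than `r` to its parent. -/
def parentGraph {V : Type*} (r : V) (par : V → V) : SimpleGraph V :=
  SimpleGraph.fromRel fun u v => v ≠ r ∧ par v = u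

section ParentGraph

variable {V : Type*} {r : V} {par : V → V} {d : V → ℕ}

lemma parentGraph_adj_par (hd : ∀ v, v ≠ r → d (par v) < d v) {v : V} (hv : v ≠ r) :
    (parentGraph r par).Adj (par v) v := by
  refine (SimpleGraph.fromRel_adj _ _ _).2 ⟨fun h => ?_, Or.inl ⟨hv, rfl⟩⟩
  have := hd v hv
  rw [h] at this
  exact lt_irrefl _ this

lemma parentGraph_connected (hd : ∀ v, v ≠ r → d (par v) < d v) :
    (parentGraph r par).Connected := by
  have key : ∀ k v, d v = k → (parentGraph r par).Reachable r v := by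
    intro k
    induction k using Nat.strong_induction_on with
    | _ k ih =>
      intro v hv
      by_cases h : v = r
      · subst h; exact SimpleGraph.Reachable.refl _
      · exact (ih _ (hv ▸ hd v h) (par v) rfl).trans (parentGraph_adj_par hd h).reachable
  have : Nonempty V := ⟨r⟩
  exact SimpleGraph.Connected.mk fun u v => (key _ u rfl).symm.trans (key _ v rfl)

/-- If the ends matched crosswise, each vertex would be the parent of the other, against the rank.
-/
lemma par_edge_injOn (hd : ∀ v, v ≠ r → d (par v) < d v) {u v : V} (hu : u ≠ r) (hv : v ≠ r)
    (h : s(par u, u) = s(par v, v)) : u = v := by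
  rcases Sym2.eq_iff.1 h with h | h
  · exact h.2
  · have h1 := hd u hu
    have h2 := hd v hv
    rw [h.1] at h1
    rw [← h.2] at h2
    omega

/-- The graph is connected and its edges correspond to the non-root vertices, so there is one edge
fewer than there are vertices. -/
lemma parentGraph_isTree [Fintype V] (hd : ∀ v, v ≠ r → d (par v) < d v) :
    (parentGraph r par).IsTree := by
  classical
  rw [SimpleGraph.isTree_iff_connected_and_card]
  refine ⟨parentGraph_connected hd, ?_⟩
  have himg : (parentGraph r par).edgeSet = (fun v => s(par v, v)) '' {v | v ≠ r} := by
    ext e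
    induction e with
    | _ a b =>
      simp only [SimpleGraph.mem_edgeSet, Set.mem_image, Set.mem_ofPred_eq]
      constructor
      · intro h
        rcases ((SimpleGraph.fromRel_adj _ _ _).1 h).2 with ⟨h1, h2⟩ | ⟨h1, h2⟩
        · exact ⟨b, h1, by rw [h2]⟩
        · exact ⟨a, h1, by rw [h2]; exact Sym2.eq_swap⟩
      · rintro ⟨v, hv, he⟩
        rw [← SimpleGraph.mem_edgeSet, ← he, SimpleGraph.mem_edgeSet]
        exact parentGraph_adj_par hd hv
  have hinj : Set.InjOn (fun v => s(par v, v)) {v | v ≠ r} :=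
    fun u hu v hv h => par_edge_injOn hd hu hv h
  rw [himg, Nat.card_image_of_injOn hinj]
  have : Nat.card {v | v ≠ r} = Fintype.card V - 1 := by
    rw [Nat.card_eq_fintype_card]
    exact Set.card_ne_eq r
  rw [this, Nat.card_eq_fintype_card]
  have : 0 < Fintype.card V := Fintype.card_pos_iff.2 ⟨r⟩
  omega

open Classical in
lemma two_le_degree_parentGraph [Fintype V] (hd : ∀ v, v ≠ r → d (par v) < d v) {u v : V}
    (hv : v ≠ r) (hu : u ≠ r) (huv : par u = v) : 2 ≤ (parentGraph r par).degree v := by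
  have h1 := (parentGraph_adj_par hd hv).symm
  have h2 := parentGraph_adj_par hd hu
  rw [huv] at h2
  have hne : par v ≠ u := by
    intro h
    have h3 := hd v hv
    have h4 := hd u hu
    rw [h] at h3
    rw [huv] at h4
    omega
  rw [← SimpleGraph.card_neighborFinset_eq_degree, ← Finset.card_pair hne]
  refine Finset.card_le_card fun z hz => ?_
  rcases Finset.mem_insert.1 hz with rfl | hz
  · simpa using h1
  · rw [Finset.mem_singleton.1 hz]; simpa using h2

end ParentGraph

/-! ### Claw-free graphs -/

lemma ClawFree.exists_adj {V : Type*} {G : SimpleGraph V} (hG : ClawFree G) {a x y z : V}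
    (hx : G.Adj a x) (hy : G.Adj a y) (hz : G.Adj a z) (hxy : x ≠ y) (hxz : x ≠ z) (hyz : y ≠ z) :
    G.Adj x y ∨ G.Adj x z ∨ G.Adj y z := by
  by_contra hcon
  push Not at hcon
  obtain ⟨h1, h2, h3⟩ := hcon
  have h1' := fun h => h1 (SimpleGraph.Adj.symm h)
  have h2' := fun h => h2 (SimpleGraph.Adj.symm h)
  have h3' := fun h => h3 (SimpleGraph.Adj.symm h)
  apply hG
  refine ⟨⟨⟨Sum.elim (fun _ => a) ![x, y, z], ?_⟩, ?_⟩⟩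
  · rintro (i | i) (j | j) h
    · rw [Subsingleton.elim i j]
    · fin_cases j <;> simp at h <;> subst h <;> simp_all
    · fin_cases i <;> simp at h <;> subst h <;> simp_all
    · fin_cases i <;> fin_cases j <;> simp_all
  · intro u v
    change G.Adj (Sum.elim (fun _ => a) ![x, y, z] u) (Sum.elim (fun _ => a) ![x, y, z] v) ↔ _
    rcases u with i | i <;> rcases v with j | j
    · simp
    · fin_cases j <;> simp [hx, hy, hz]
    · fin_cases i <;> simp [hx.symm, hy.symm, hz.symm]
    · fin_cases i <;> fin_cases j <;> simp_all

/-! ### Invariants of depth-first search -/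

section Search

variable {V : Type*} {G : SimpleGraph V} {w : V → ℝ} {r : V}

/-- `a` is an ancestor of `b` (or equal to it) in the forest with (parent, child) pairs `E`. -/
def Anc (E : Set (V × V)) : V → V → Prop :=
  Relation.ReflTransGen fun a b => (a, b) ∈ E

/-- Consecutive entries of the stack are (child, parent) pairs, and the last entry is the root. -/
def StackPath (E : Set (V × V)) (r : V) : List V → Prop
  | [] => True
  | [x] => x = r
  | x :: y :: s => (y, x) ∈ E ∧ StackPath E r (y :: s)

lemma Anc.mono {E F : Set (V × V)} (h : E ⊆ F) {a b : V} (hab : Anc E a b) : Anc F a b :=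
  Relation.ReflTransGen.mono (fun _ _ hxy => h hxy) _ _ hab

lemma StackPath.mono {E F : Set (V × V)} (h : E ⊆ F) {s : List V} (hs : StackPath E r s) :
    StackPath F r s := by
  induction s with
  | nil => trivial
  | cons x s ih =>
    cases s with
    | nil => exact hs
    | cons y s => exact ⟨h hs.1, ih hs.2⟩

lemma StackPath.anc {E : Set (V × V)} {x : V} {s : List V} (hs : StackPath E r (x :: s)) {y : V}
    (hy : y ∈ x :: s) : Anc E y x := by
  induction s generalizing x with
  | nil =>
    rw [List.mem_singleton.1 hy]; exact Relation.ReflTransGen.refl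
  | cons z s ih =>
    rcases List.mem_cons.1 hy with rfl | hy
    · exact Relation.ReflTransGen.refl
    · exact (ih hs.2 hy).tail hs.1

lemma StackPath.tail {E : Set (V × V)} {x : V} {s : List V} (hs : StackPath E r (x :: s)) :
    StackPath E r s := by
  cases s with
  | nil => trivial
  | cons z s => exact hs.2

lemma Anc.rank_le {E : Set (V × V)} {d : V → ℕ} (hd : ∀ a b, (a, b) ∈ E → d a < d b) {a b : V}
    (h : Anc E a b) : d a ≤ d b := by
  induction h with
  | refl => exact le_rfl
  | tail _ h ih => exact ih.trans (hd _ _ h).le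

/-- As `y` has no children, a path that uses the new pair can never leave `y` again. -/
lemma Anc.of_insert {E : Set (V × V)} {x y c z : V} (hy : ∀ b, (y, b) ∉ E)
    (h : Anc (insert (x, y) E) c z) (hz : z ≠ y) : Anc E c z := by
  induction h with
  | refl => exact Relation.ReflTransGen.refl
  | @tail b z _ h ih =>
    rcases h with h | h
    · exact absurd (congrArg Prod.snd h) hz
    · exact (ih fun hb => hy z (hb ▸ h)).tail h

/-- What holds in every reachable configuration of greedy depth-first search. -/
structure SearchInv (G : SimpleGraph V) (w : V → ℝ) (r : V) (s : List V) (vis : Set V)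
    (E : Set (V × V)) : Prop where
  root_vis : r ∈ vis
  stack_vis : ∀ x ∈ s, x ∈ vis
  nodup : s.Nodup
  path : StackPath E r s
  parent_vis : ∀ a c, (a, c) ∈ E → a ∈ vis
  child_vis : ∀ a c, (a, c) ∈ E → c ∈ vis
  child_ne : ∀ a c, (a, c) ∈ E → c ≠ r
  unique : ∀ a b c, (a, c) ∈ E → (b, c) ∈ E → a = b
  covered : ∀ v ∈ vis, v ≠ r → ∃ a, (a, v) ∈ E
  adj : ∀ a c, (a, c) ∈ E → G.Adj a c
  finished : ∀ v ∈ vis, v ∉ s → ∀ z, G.Adj v z → z ∈ vis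
  rank : ∃ d : V → ℕ, ∀ a c, (a, c) ∈ E → d a < d c
  related : ∀ u ∈ vis, ∀ v ∈ vis, G.Adj u v → Anc E u v ∨ Anc E v u
  greedy : ∀ a c, (a, c) ∈ E → ∀ z, G.Adj a z → z ∉ vis ∨ Anc E c z → w z ≤ w c
  siblings : ∀ a b c, (a, b) ∈ E → (a, c) ∈ E → b ≠ c → ¬ G.Adj b c

lemma SearchInv.start : SearchInv G w r [r] {r} ∅ where
  root_vis := rfl
  stack_vis := by simp
  nodup := by simp
  path := rfl
  parent_vis := by simp
  child_vis := by simp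
  child_ne := by simp
  unique := by simp
  covered := by simp
  adj := by simp
  finished := by simp
  rank := ⟨fun _ => 0, by simp⟩
  related := by
    rintro u rfl v rfl h
    exact absurd h (G.irrefl)
  greedy := by simp
  siblings := by simp

/-- Stack entries are ancestors of `x`, so their rank is at most that of `x`; a child has larger
rank. -/
lemma SearchInv.child_notMem_stack {x y : V} {s : List V} {vis : Set V} {E : Set (V × V)}
    (h : SearchInv G w r (x :: s) vis E) (hxy : (x, y) ∈ E) : y ∉ x :: s := by
  intro hy
  obtain ⟨d, hd⟩ := h.rank
  have h1 := (h.path.anc hy).rank_le hd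
  have h2 := hd _ _ hxy
  omega

lemma SearchInv.advance {x y : V} {s : List V} {vis : Set V} {E : Set (V × V)}
    (h : SearchInv G w r (x :: s) vis E) (hxy : G.Adj x y) (hy : y ∉ vis)
    (hmax : ∀ z, G.Adj x z → z ∉ vis → w z ≤ w y) :
    SearchInv G w r (y :: x :: s) (insert y vis) (insert (x, y) E) := by
  have hx : x ∈ vis := h.stack_vis x (by simp)
  have hyE : ∀ b, (y, b) ∉ E := fun b hb => hy (h.parent_vis _ _ hb)
  have hyE' : ∀ b, (b, y) ∉ E := fun b hb => hy (h.child_vis _ _ hb)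
  have hsub : E ⊆ insert (x, y) E := Set.subset_insert _ _
  -- A visited neighbour of the unvisited `y` cannot be finished, so it is on the stack and hence an
  -- ancestor of `x`.
  have hup : ∀ u ∈ vis, G.Adj u y → Anc (insert (x, y) E) u y := by
    intro u hu huy
    have hus : u ∈ x :: s := by
      by_contra hus
      exact hy (h.finished u hu hus y huy)
    exact ((h.path.anc hus).mono hsub).tail (Set.mem_insert _ _)
  refine ⟨Or.inr h.root_vis, ?_, ?_, ?_, ?_, ?_, ?_, ?_, ?_, ?_, ?_, ?_, ?_, ?_, ?_⟩
  · intro z hz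
    rcases List.mem_cons.1 hz with rfl | hz
    · exact Or.inl rfl
    · exact Or.inr (h.stack_vis z hz)
  · exact List.nodup_cons.2 ⟨fun hys => hy (h.stack_vis y hys), h.nodup⟩
  · exact ⟨Set.mem_insert _ _, h.path.mono hsub⟩
  · rintro a c (hac | hac)
    · obtain ⟨rfl, rfl⟩ := Prod.mk.inj hac; exact Or.inr hx
    · exact Or.inr (h.parent_vis _ _ hac)
  · rintro a c (hac | hac)
    · obtain ⟨rfl, rfl⟩ := Prod.mk.inj hac; exact Or.inl rfl
    · exact Or.inr (h.child_vis _ _ hac)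
  · rintro a c (hac | hac)
    · obtain ⟨rfl, rfl⟩ := Prod.mk.inj hac
      exact fun hc => hy (hc ▸ h.root_vis)
    · exact h.child_ne _ _ hac
  · rintro a b c (hac | hac) (hbc | hbc)
    · exact (Prod.mk.inj hac).1.trans (Prod.mk.inj hbc).1.symm
    · obtain ⟨rfl, rfl⟩ := Prod.mk.inj hac; exact absurd hbc (hyE' _)
    · obtain ⟨rfl, rfl⟩ := Prod.mk.inj hbc; exact absurd hac (hyE' _)
    · exact h.unique _ _ _ hac hbc
  · rintro v (rfl | hv) hvr
    · exact ⟨x, Set.mem_insert _ _⟩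
    · obtain ⟨a, ha⟩ := h.covered v hv hvr
      exact ⟨a, hsub ha⟩
  · rintro a c (hac | hac)
    · obtain ⟨rfl, rfl⟩ := Prod.mk.inj hac; exact hxy
    · exact h.adj _ _ hac
  · rintro v (rfl | hv) hvs z hz
    · exact absurd (List.mem_cons_self) hvs
    · exact Or.inr (h.finished v hv (fun hv' => hvs (List.mem_cons_of_mem _ hv')) z hz)
  · classical
    obtain ⟨d, hd⟩ := h.rank
    -- No pair of `E` contains `y`, so its rank can be reset freely.
    refine ⟨Function.update d y (d x + 1), ?_⟩
    rintro a c (hac | hac)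
    · obtain ⟨rfl, rfl⟩ := Prod.mk.inj hac
      simp [Function.update_of_ne hxy.ne]
    · have ha : a ≠ y := fun ha => hyE c (ha ▸ hac)
      have hc : c ≠ y := fun hc => hyE' a (hc ▸ hac)
      rw [Function.update_of_ne ha, Function.update_of_ne hc]
      exact hd _ _ hac
  · rintro u (rfl | hu) v (rfl | hv) huv
    · exact absurd huv G.irrefl
    · exact Or.inr (hup v hv huv.symm)
    · exact Or.inl (hup u hu huv)
    · exact (h.related u hu v hv huv).imp (Anc.mono hsub) (Anc.mono hsub)
  -- The alternative `z ∉ vis` makes the clause inductive: a later descendant of `c` is still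
  -- unvisited when the pair of `c` is added, and the inequality is recorded then.
  · rintro a c (hac | hac) z haz hz
    · obtain ⟨rfl, rfl⟩ := Prod.mk.inj hac
      by_cases hzc : z = c
      · rw [hzc]
      rcases hz with hz | hz
      · exact hmax z haz fun hz' => hz (Or.inr hz')
      · rcases Relation.ReflTransGen.cases_head (hz.of_insert hyE hzc) with hz | ⟨b, hb, _⟩
        · exact absurd hz.symm hzc
        · exact absurd hb (hyE b)
    · by_cases hzy : z = y
      · exact h.greedy a c hac z haz (Or.inl (hzy ▸ hy))
      · refine h.greedy a c hac z haz (hz.imp (fun hz hz' => hz (Or.inr hz')) ?_)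
        exact fun hz => hz.of_insert hyE hzy
  -- An earlier child of `x` is off the stack and therefore finished, so it has no unvisited
  -- neighbour.
  · have key : ∀ b, (x, b) ∈ E → ¬ G.Adj b y := fun b hb hby =>
      hy (h.finished b (h.child_vis _ _ hb) (h.child_notMem_stack hb) y hby)
    rintro a b c (hab | hab) (hac | hac) hbc
    · exact absurd ((Prod.mk.inj hab).2.trans (Prod.mk.inj hac).2.symm) hbc
    · obtain ⟨rfl, rfl⟩ := Prod.mk.inj hab
      exact fun hb => key c hac hb.symm
    · obtain ⟨rfl, rfl⟩ := Prod.mk.inj hac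
      exact key b hab
    · exact h.siblings a b c hab hac hbc

lemma SearchInv.backtrack {x : V} {s : List V} {vis : Set V} {E : Set (V × V)}
    (h : SearchInv G w r (x :: s) vis E) (hx : ∀ z, G.Adj x z → z ∈ vis) :
    SearchInv G w r s vis E :=
  { h with
    stack_vis := fun z hz => h.stack_vis z (List.mem_cons_of_mem _ hz)
    nodup := (List.nodup_cons.1 h.nodup).2
    path := h.path.tail
    finished := fun v hv hvs z hz => by
      by_cases hvx : v = x
      · exact hx z (hvx ▸ hz)
      · exact h.finished v hv (by simp [hvx, hvs]) z hz }

lemma GreedyDFS.inv {s : List V} {vis : Set V} {E : Set (V × V)} (h : GreedyDFS G w r s vis E) :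
    SearchInv G w r s vis E := by
  induction h with
  | start => exact SearchInv.start
  | advance _ hxy hy hmax ih => exact ih.advance hxy hy hmax
  | backtrack _ hx ih => exact ih.backtrack hx

/-- In a claw-free graph every node of a depth-first search tree has at most two children. -/
lemma SearchInv.isBinary {s : List V} {vis : Set V} {E : Set (V × V)}
    (h : SearchInv G w r s vis E) (hG : ClawFree G) : IsBinary E := by
  intro x
  by_contra hcon
  push Not at hcon
  obtain ⟨t, ht, ht3⟩ := Set.exists_subset_encard_eq (k := 2 + 1)
    (Order.add_one_le_of_lt hcon)
  obtain ⟨a, b, c, hab, hac, hbc, rfl⟩ := Set.encard_eq_three.1 (ht3.trans (by norm_num))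
  have ha : (x, a) ∈ E := ht (by simp)
  have hb : (x, b) ∈ E := ht (by simp)
  have hc : (x, c) ∈ E := ht (by simp)
  rcases hG.exists_adj (h.adj _ _ ha) (h.adj _ _ hb) (h.adj _ _ hc) hab hac hbc with h1 | h1 | h1
  · exact h.siblings x a b ha hb hab h1
  · exact h.siblings x a c ha hc hac h1
  · exact h.siblings x b c hb hc hbc h1

/-- Greedy depth-first search can always be completed. -/
lemma GreedyDFS.exists_complete [Finite V] {s : List V} {vis : Set V} {E : Set (V × V)}
    (h : GreedyDFS G w r s vis E) : ∃ F, IsGreedyDFSTree G w r F := by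
  -- An advance removes one unvisited vertex but lengthens the stack by one, whence the factor 2 in
  -- the measure.
  have key : ∀ k (s : List V) (vis : Set V) (E : Set (V × V)), GreedyDFS G w r s vis E →
      2 * visᶜ.ncard + s.length = k → ∃ F, IsGreedyDFSTree G w r F := by
    intro k
    induction k using Nat.strong_induction_on with
    | _ k ih =>
      intro s vis E h hk
      cases s with
      | nil => exact ⟨E, vis, h⟩
      | cons x s =>
        by_cases hx : ∀ z, G.Adj x z → z ∈ vis
        · exact ih _ (by simp only [List.length_cons] at hk; omega) s vis E (h.backtrack hx) rfl
        · push Not at hx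
          obtain ⟨z, hz⟩ := hx
          obtain ⟨y, hy, hmax⟩ := Set.exists_max_image {z | G.Adj x z ∧ z ∉ vis} w
            (Set.toFinite _) ⟨z, hz⟩
          refine ih _ ?_ _ _ _ (h.advance hy.1 hy.2 fun z h1 h2 => hmax z ⟨h1, h2⟩) rfl
          have h1 : (insert y vis)ᶜ = visᶜ \ {y} := by
            ext u; simp only [Set.mem_compl_iff, Set.mem_insert_iff, Set.mem_sdiff,
              Set.mem_singleton_iff]; tauto
          have h2 : (visᶜ \ {y}).ncard + 1 = visᶜ.ncard :=
            Set.ncard_sdiff_singleton_add_one hy.2 (Set.toFinite _)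
          rw [h1]
          simp only [List.length_cons] at hk ⊢
          omega
  exact key _ s vis E h rfl

/-- With an empty stack every visited vertex is finished, so the visited set is closed under
adjacency. -/
lemma SearchInv.vis_eq_univ {vis : Set V} {E : Set (V × V)} (h : SearchInv G w r [] vis E)
    (hG : G.Connected) : vis = Set.univ := by
  refine Set.eq_univ_of_forall fun v => ?_
  obtain ⟨p⟩ := hG.preconnected r v
  have : ∀ u v, G.Walk u v → u ∈ vis → v ∈ vis := by
    intro u v p
    induction p with
    | nil => exact id
    | cons hadj _ ih => exact fun hu => ih (h.finished _ hu (by simp) _ hadj)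
  exact this r v p h.root_vis

end Search

/-! ### Greedy search trees in terms of parent functions -/

section Charging

variable {V : Type*} {G : SimpleGraph V} {w : V → ℝ} {r : V} {par par' : V → V}

/-- The (parent, child) pairs of the tree with root `r` and parent function `par`. -/
def parentPairs (r : V) (par : V → V) : Set (V × V) :=
  {e | e.2 ≠ r ∧ par e.2 = e.1}

/-- The properties of a spanning greedy depth-first search tree. -/
structure SearchTree (G : SimpleGraph V) (w : V → ℝ) (r : V) (par : V → V) : Prop where
  adj : ∀ v, v ≠ r → G.Adj (par v) v
  rank : ∃ d : V → ℕ, ∀ v, v ≠ r → d (par v) < d v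
  related : ∀ u v, G.Adj u v → Anc (parentPairs r par) u v ∨ Anc (parentPairs r par) v u
  greedy : ∀ c, c ≠ r → ∀ z, G.Adj (par c) z → Anc (parentPairs r par) c z → w z ≤ w c

/-- `l` has no children. -/
def IsLeaf (r : V) (par : V → V) (l : V) : Prop :=
  ∀ v, v ≠ r → par v ≠ l

/-- `c` is a proper ancestor of `l` whose parent is adjacent to `l`. -/
def Guards (G : SimpleGraph V) (r : V) (par : V → V) (l c : V) : Prop :=
  c ≠ r ∧ c ≠ l ∧ Anc (parentPairs r par) c l ∧ G.Adj l (par c)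

/-- The tree edge above `c` spans a triangle with `l`, is not incident with the parent of `l` from
above, and the tree edge above `par c` does not span a triangle with `l`. -/
def RunTop (G : SimpleGraph V) (r : V) (par : V → V) (l c : V) : Prop :=
  c ≠ r ∧ G.Adj l c ∧ G.Adj l (par c) ∧ c ≠ par l ∧ (par c = r ∨ ¬ G.Adj l (par (par c)))

lemma SearchTree.pairs_rank {d : V → ℕ} (hd : ∀ v, v ≠ r → d (par v) < d v) :
    ∀ a b, (a, b) ∈ parentPairs r par → d a < d b := by
  rintro a b ⟨h1, h2⟩
  have := hd b h1
  rwa [show par b = a from h2] at this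

lemma Anc.exists_child {a l : V} (h : Anc (parentPairs r par) a l) (hne : a ≠ l) :
    ∃ c, c ≠ r ∧ par c = a ∧ Anc (parentPairs r par) c l := by
  rcases Relation.ReflTransGen.cases_head h with h | ⟨c, hc, h⟩
  · exact absurd h hne
  · exact ⟨c, hc.1, hc.2, h⟩

lemma Anc.parent {a l : V} (h : Anc (parentPairs r par) a l) (hne : a ≠ l) :
    l ≠ r ∧ Anc (parentPairs r par) a (par l) := by
  rcases Relation.ReflTransGen.cases_tail h with h | ⟨c, h, hc⟩
  · exact absurd h.symm hne
  · exact ⟨hc.1, (show par l = c from hc.2) ▸ h⟩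

lemma IsLeaf.eq_of_anc {l v : V} (hl : IsLeaf r par l) (h : Anc (parentPairs r par) l v) :
    l = v := by
  by_contra hne
  obtain ⟨c, hc, hcl, -⟩ := h.exists_child hne
  exact hl c hc hcl

lemma Guards.not_isLeaf {l c : V} (h : Guards G r par l c) : ¬ IsLeaf r par c :=
  fun hc => h.2.1 (hc.eq_of_anc h.2.2.1)

lemma Guards.ne_root {l c : V} (h : Guards G r par l c) : l ≠ r :=
  (h.2.2.1.parent h.2.1).1

/-! ### Leaves, guards and triangles in a search tree -/

namespace SearchTree

lemma anc_of_adj_leaf (T : SearchTree G w r par) {l c : V} (hl : IsLeaf r par l) (h : G.Adj l c) :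
    Anc (parentPairs r par) c l := by
  rcases T.related l c h with h' | h'
  · exact absurd (hl.eq_of_anc h') h.ne
  · exact h'

lemma not_adj_leaves (T : SearchTree G w r par) {l m : V} (hl : IsLeaf r par l)
    (hm : IsLeaf r par m) : ¬ G.Adj l m :=
  fun h => h.ne (hm.eq_of_anc (T.anc_of_adj_leaf hl h)).symm

/-- Leaves are pairwise non-adjacent, so these four vertices would form a claw. Applied to `a = par
c`, this bounds by two the number of leaves guarded by `c`. -/
lemma three_leaves (T : SearchTree G w r par) (hG : ClawFree G) {a x y z : V}
    (hx : IsLeaf r par x) (hy : IsLeaf r par y)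
    (hz : IsLeaf r par z) (hax : G.Adj x a) (hay : G.Adj y a) (haz : G.Adj z a)
    (hxy : x ≠ y) (hxz : x ≠ z) (hyz : y ≠ z) : False := by
  rcases hG.exists_adj hax.symm hay.symm haz.symm hxy hxz hyz with h | h | h
  · exact T.not_adj_leaves hx hy h
  · exact T.not_adj_leaves hx hz h
  · exact T.not_adj_leaves hy hz h

/-- The vertex `par c` has smaller rank than `c`, and `c` is `par l` or an ancestor of it. -/
lemma par_ne_par (T : SearchTree G w r par) {l c : V} (h : Guards G r par l c) : par c ≠ par l := by
  intro he
  obtain ⟨d, hd⟩ := T.rank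
  have h1 := (h.2.2.1.parent h.2.1).2.rank_le (pairs_rank hd)
  have h2 := hd c h.1
  rw [he] at h2
  omega

lemma guards_of_triangle (T : SearchTree G w r par) {l c : V} (hl : IsLeaf r par l)
    (hc : c ≠ r) (h1 : G.Adj l c)
    (h2 : G.Adj l (par c)) : Guards G r par l c :=
  ⟨hc, h1.ne', T.anc_of_adj_leaf hl h1, h2⟩

lemma guards_of_runTop (T : SearchTree G w r par) {l c : V} (hl : IsLeaf r par l)
    (h : RunTop G r par l c) :
    Guards G r par l c :=
  T.guards_of_triangle hl h.1 h.2.1 h.2.2.1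

/-- Climb as long as the next vertex up is still adjacent to `l`; the rank forces the climb to stop.
-/
lemma exists_runTop (T : SearchTree G w r par) {l c : V} (hl : IsLeaf r par l)
    (hc : c ≠ r) (h1 : G.Adj l c)
    (h2 : G.Adj l (par c)) (h3 : c ≠ par l) : ∃ b, RunTop G r par l b := by
  obtain ⟨d, hd⟩ := T.rank
  induction hk : d c using Nat.strong_induction_on generalizing c with
  | _ k ih =>
    by_cases h : par c = r ∨ ¬ G.Adj l (par (par c))
    · exact ⟨c, hc, h1, h2, h3, h⟩
    · push Not at h
      exact ih _ (hk ▸ hd c hc) h.1 h2 h.2 (T.par_ne_par (T.guards_of_triangle hl hc h1 h2)) rfl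

/-- Among the three neighbours `par (par c)`, `l`, `m` of `par c` some two are adjacent, and the two
leaves are not. This is how a shared neighbour produces a triangle with a tree edge. -/
lemma adj_grandparent (T : SearchTree G w r par) (hG : ClawFree G) {l m c : V}
    (hl : IsLeaf r par l) (hm : IsLeaf r par m)
    (hlm : l ≠ m) (hc : par c ≠ r) (h1 : G.Adj l (par c)) (h2 : G.Adj m (par c)) :
    G.Adj l (par (par c)) ∨ G.Adj m (par (par c)) := by
  rcases hG.exists_adj (T.adj _ hc).symm h1.symm h2.symm (hl _ hc) (hm _ hc) hlm with h | h | h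
  · exact Or.inl h.symm
  · exact Or.inr h.symm
  · exact absurd h (T.not_adj_leaves hl hm)

/-- As a descendant of `c` adjacent to `par c`, the leaf was a candidate when the greedy search
chose `c`. -/
lemma weight_le (T : SearchTree G w r par) {l c : V} (h : Guards G r par l c) : w l ≤ w c :=
  T.greedy c h.1 l h.2.2.2.symm h.2.2.1

/-- The guard is the child of `a` on the path to `l`; it differs from `l` because `a` is not the
parent of `l`. -/
lemma exists_guard (T : SearchTree G w r par) {l a : V} (hl : IsLeaf r par l) (ha : G.Adj l a)
    (hal : a ≠ par l) :
    ∃ c, Guards G r par l c ∧ par c = a := by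
  obtain ⟨c, hc, hca, hcl⟩ := (T.anc_of_adj_leaf hl ha).exists_child ha.ne'
  refine ⟨c, ⟨hc, ?_, hcl, hca ▸ ha⟩, hca⟩
  rintro rfl
  exact hal hca.symm

end SearchTree

/-! ### Selecting leaves and inserting them into tree edges -/

/-- A choice of an edge (given by its lower end) for some of the leaves, and the set `X` of those
leaves that are inserted into their edge. -/
structure Selection (G : SimpleGraph V) (w : V → ℝ) (r : V) (par : V → V) (κ : V → Option V)
    (X : Set V) : Prop where
  leaf : ∀ l c, κ l = some c → IsLeaf r par l
  runTop : ∀ l c, κ l = some c → RunTop G r par l c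
  maximal : ∀ l c, IsLeaf r par l → κ l = none → RunTop G r par l c → ∃ m, κ m = some c
  chosen : ∀ l ∈ X, ∃ c, κ l = some c
  kept : ∀ l c, κ l = some c → l ∉ X →
    w l ≤ w (par l) ∧ ∀ u, u ≠ r → par u = par l → u ≠ l → u ∈ X
  removed : ∀ q, ¬ IsLeaf r par q → (∀ u, u ≠ r → par u = q → u ∈ X) →
    ∃ u ∈ X, u ≠ r ∧ par u = q ∧ w q ≤ w u

/-- `par'` is the parent function after the insertions. -/
structure Inserted (par : V → V) (κ : V → Option V) (X : Set V) (par' : V → V) : Prop where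
  leaf : ∀ l c, l ∈ X → κ l = some c → par' l = par c
  child : ∀ l c, l ∈ X → κ l = some c → par' c = l
  other : ∀ v, v ∉ X → (∀ l ∈ X, κ l ≠ some v) → par' v = par v

/-- The leaf `f` of the new tree charges the vertex `x` fully and the vertex `y` by one half, on
behalf of the leaf `l` of the old tree. -/
inductive Charge (G : SimpleGraph V) (w : V → ℝ) (r : V) (par : V → V) (κ : V → Option V)
    (X : Set V) : V → V → V → V → Prop
  | kept {l y : V} : κ l = some y → l ∉ X → Charge G w r par κ X l l (par l) y
  | removed {l y : V} : κ l = some y → l ∈ X → w (par l) ≤ w l →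
      Charge G w r par κ X (par l) l l y
  | lonely {l x y : V} : IsLeaf r par l → κ l = none →
      (∀ c, c ≠ r → G.Adj l c → G.Adj l (par c) → c = par l) →
      Guards G r par l x → Guards G r par l y → x ≠ y → par x ≠ r →
      Charge G w r par κ X l l x y
  | blocked {l m x y : V} : IsLeaf r par l → κ l = none → κ m = some y → par y = r →
      par x = y → Guards G r par l x → Guards G r par l y →
      Charge G w r par κ X l l x y

variable {κ : V → Option V} {X : Set V}

lemma Selection.notMem_of_none (S : Selection G w r par κ X) {l : V} (h : κ l = none) :
    l ∉ X := fun hl => by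
  obtain ⟨c, hc⟩ := S.chosen l hl
  rw [h] at hc
  cases hc

lemma Selection.isLeaf_of_mem (S : Selection G w r par κ X) {l : V} (hl : l ∈ X) :
    IsLeaf r par l := by
  obtain ⟨c, hc⟩ := S.chosen l hl
  exact S.leaf l c hc

lemma Charge.isLeaf (S : Selection G w r par κ X) {f l x y : V}
    (h : Charge G w r par κ X f l x y) : IsLeaf r par l := by
  cases h with
  | kept h1 _ => exact S.leaf _ _ h1
  | removed h1 _ _ => exact S.leaf _ _ h1
  | lonely h _ _ _ _ _ _ => exact h
  | blocked h _ _ _ _ _ _ => exact h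

lemma Charge.guards (T : SearchTree G w r par) (S : Selection G w r par κ X) {f l x y : V}
    (h : Charge G w r par κ X f l x y) : Guards G r par l y := by
  cases h with
  | kept h1 _ => exact T.guards_of_runTop (S.leaf _ _ h1) (S.runTop _ _ h1)
  | removed h1 _ _ => exact T.guards_of_runTop (S.leaf _ _ h1) (S.runTop _ _ h1)
  | lonely _ _ _ _ h _ _ => exact h
  | blocked _ _ _ _ _ _ h => exact h

/-- The charging leaf is `par l` if `l ∈ X` and `l` otherwise. Hence distinct new leaves charge on
behalf of distinct old leaves. -/
lemma Charge.unique (S : Selection G w r par κ X) {f f' l x y x' y' : V}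
    (h : Charge G w r par κ X f l x y) (h' : Charge G w r par κ X f' l x' y') : f = f' := by
  have := fun l h => S.notMem_of_none (l := l) h
  cases h <;> cases h' <;> simp_all

lemma Charge.weight_le (T : SearchTree G w r par) (S : Selection G w r par κ X) {f l x y : V}
    (h : Charge G w r par κ X f l x y) : w f ≤ w x ∧ w f ≤ w y := by
  have hy := T.weight_le (h.guards T S)
  cases h with
  | kept h1 h2 => exact ⟨(S.kept _ _ h1 h2).1, hy⟩
  | removed h1 _ h3 => exact ⟨h3, h3.trans hy⟩
  | lonely _ _ _ h _ _ _ => exact ⟨T.weight_le h, hy⟩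
  | blocked _ _ _ _ _ h _ => exact ⟨T.weight_le h, hy⟩

/-- The part of the disjointness of charges that concerns vertices charged fully by selected
leaves. -/
lemma Charge.ne_of_selected (T : SearchTree G w r par) (S : Selection G w r par κ X)
    {f l x y f' l' x' y' : V} (h : Charge G w r par κ X f l x y)
    (h' : Charge G w r par κ X f' l' x' y') (hne : l ≠ l') (hl : κ l ≠ none) :
    x ≠ x' ∧ x ≠ y' := by
  have hy' := h'.guards T S
  have hleaf' := h'.isLeaf S
  have hlr := (h.guards T S).ne_root
  cases h with
  | removed h1 h2 h3 =>
    have hleaf := S.leaf _ _ h1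
    refine ⟨?_, fun he => hy'.not_isLeaf (he ▸ hleaf)⟩
    cases h' with
    | kept h1' _ => exact fun he => hleaf _ hy'.ne_root he.symm
    | removed => exact hne
    | lonely _ _ _ hx' _ _ _ => exact fun he => hx'.not_isLeaf (he ▸ hleaf)
    | blocked _ _ _ _ _ hx' _ => exact fun he => hx'.not_isLeaf (he ▸ hleaf)
  | kept h1 h2 =>
    have hleaf := S.leaf _ _ h1
    have hoth := (S.kept _ _ h1 h2).2
    -- All children of `par f` other than `f` are inserted, hence old leaves, so the only leaves
    -- below `par f` are its children.
    have hbelow : ∀ c, Guards G r par l' c → par f = c → l' ∈ X ∧ par l' = par f := by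
      intro c hc he
      obtain ⟨u, hur, huc, hul⟩ := hc.2.2.1.exists_child hc.2.1
      by_cases hu : u = f
      · exact absurd (hleaf.eq_of_anc (hu ▸ hul)) hne
      · have huX := hoth u hur (huc.trans he.symm) hu
        obtain rfl := (S.isLeaf_of_mem huX).eq_of_anc hul
        exact ⟨huX, huc.trans he.symm⟩
    cases h' with
    | kept h1' h2' =>
      refine ⟨fun he => h2' (hoth _ hy'.ne_root he.symm hne.symm), fun he => ?_⟩
      exact h2' (hbelow _ hy' he).1
    | removed h1' h2' h3' =>
      refine ⟨fun he => hleaf' f hlr he, fun he => ?_⟩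
      have := hbelow _ hy' he
      exact (S.runTop _ _ h1').2.2.2.1 (he.symm.trans this.2.symm)
    | lonely _ hn _ hx' _ _ _ =>
      exact ⟨fun he => S.notMem_of_none hn (hbelow _ hx' he).1,
        fun he => S.notMem_of_none hn (hbelow _ hy' he).1⟩
    | blocked _ hn _ _ _ hx' _ =>
      exact ⟨fun he => S.notMem_of_none hn (hbelow _ hx' he).1,
        fun he => S.notMem_of_none hn (hbelow _ hy' he).1⟩
  | lonely _ hn => exact absurd hn hl
  | blocked _ hn => exact absurd hn hl

/-- If `x` guarded `l'` as well, one of the two leaves would be adjacent to `par (par x)`. For `l`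
this is a triangle excluded by `hgood`, so it happens for `l'`. Then the edge above `x` is not a run
top of `l'`, and `l'` is not lonely either. If `l'` is blocked, either its half charge is a child of
the root, unlike `x`, or `l`, `l'` and `m` are three leaves at `y'`. -/
lemma Charge.ne_of_lonely (hG : ClawFree G) (T : SearchTree G w r par)
    (S : Selection G w r par κ X) {l x f' l' x' y' : V} (hl : IsLeaf r par l) (hn : κ l = none)
    (hgood : ∀ c, c ≠ r → G.Adj l c → G.Adj l (par c) → c = par l)
    (hx : Guards G r par l x) (hxr : par x ≠ r) (h' : Charge G w r par κ X f' l' x' y')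
    (hne : l ≠ l') : (κ l' = none → x ≠ x') ∧ x ≠ y' := by
  have hy' := h'.guards T S
  have hleaf' := h'.isLeaf S
  have key : Guards G r par l' x → G.Adj l' (par (par x)) := by
    intro hg
    rcases T.adj_grandparent hG hl hleaf' hne hxr hx.2.2.2 hg.2.2.2 with h | h
    · exact absurd (hgood _ hxr hx.2.2.2 h) (T.par_ne_par hx)
    · exact h
  have hsel : κ l' = some y' → x ≠ y' := by
    rintro h rfl
    rcases (S.runTop _ _ h).2.2.2.2 with h2 | h2
    · exact hxr h2
    · exact h2 (key hy')
  cases h' with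
  | kept h1 _ => exact ⟨fun h => by simp [h] at h1, hsel h1⟩
  | removed h1 _ _ => exact ⟨fun h => by simp [h] at h1, hsel h1⟩
  | lonely _ _ hgood' hx' _ _ _ =>
    have : ¬ Guards G r par f' x := fun hg =>
      T.par_ne_par hg (hgood' _ hxr hg.2.2.2 (key hg))
    exact ⟨fun _ he => this (he ▸ hx'), fun he => this (he ▸ hy')⟩
  | @blocked _ m _ _ _ hn' hm hyr hxy hx' _ =>
    refine ⟨?_, fun he => hxr (he ▸ hyr)⟩
    rintro - rfl
    rw [hxy] at hxr
    refine T.three_leaves hG hl hleaf' (S.leaf _ _ hm) (a := y') (hxy ▸ hx.2.2.2)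
      (hxy ▸ hx'.2.2.2) (S.runTop _ _ hm).2.1 hne ?_ ?_
    · rintro rfl; simp [hn] at hm
    · rintro rfl; simp [hn'] at hm

/-- The leaves `l` and `m` are both adjacent to `y = par x`, so a third leaf guarded by `x` would
complete a claw. The leaf `m` itself has `y`, not `x`, as its half charge. -/
lemma Charge.ne_of_blocked (hG : ClawFree G) (T : SearchTree G w r par)
    (S : Selection G w r par κ X) {l m x y f' l' x' y' : V} (hl : IsLeaf r par l)
    (hn : κ l = none) (hm : κ m = some y) (hxy : par x = y)
    (hx : Guards G r par l x) (hy : Guards G r par l y) (h' : Charge G w r par κ X f' l' x' y')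
    (hne : l ≠ l') : (κ l' = none → x ≠ x') ∧ x ≠ y' := by
  have hy' := h'.guards T S
  have hleaf' := h'.isLeaf S
  have hxney : x ≠ y := by
    rintro rfl
    exact (T.adj x hx.1).ne hxy
  have key : Guards G r par l' x → l' ≠ m → False := fun hg hl'm =>
    T.three_leaves hG hl hleaf' (S.leaf _ _ hm) (a := y) (hxy ▸ hx.2.2.2)
      (hxy ▸ hg.2.2.2) (S.runTop _ _ hm).2.1 hne (by rintro rfl; simp [hn] at hm) hl'm
  have hsel : κ l' = some y' → x ≠ y' := by
    rintro h rfl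
    refine key hy' ?_
    rintro rfl
    exact hxney (Option.some.inj (h.symm.trans hm))
  cases h' with
  | kept h1 _ => exact ⟨fun h => by simp [h] at h1, hsel h1⟩
  | removed h1 _ _ => exact ⟨fun h => by simp [h] at h1, hsel h1⟩
  | lonely _ hn' _ hx' _ _ _ =>
    have hl'm : f' ≠ m := by rintro rfl; simp [hn'] at hm
    exact ⟨fun _ he => key (he ▸ hx') hl'm, fun he => key (he ▸ hy') hl'm⟩
  | @blocked _ m' _ _ _ hn' hm' hyr hxy' hx' _ =>
    have hl'm : f' ≠ m := by rintro rfl; simp [hn'] at hm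
    exact ⟨fun _ he => key (he ▸ hx') hl'm, fun he => key (he ▸ hy') hl'm⟩

/-- The lemmas on unselected leaves compare full charges only with other unselected leaves; the
mixed case comes from `Charge.ne_of_selected` with the roles exchanged. -/
lemma Charge.disjoint (hG : ClawFree G) (T : SearchTree G w r par)
    (S : Selection G w r par κ X) {f l x y f' l' x' y' : V} (h : Charge G w r par κ X f l x y)
    (h' : Charge G w r par κ X f' l' x' y') (hne : l ≠ l') : x ≠ x' ∧ x ≠ y' := by
  by_cases hl : κ l = none
  · have hnn : (κ l' = none → x ≠ x') ∧ x ≠ y' := by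
      cases h with
      | kept h1 _ => simp [hl] at h1
      | removed h1 _ _ => simp [hl] at h1
      | lonely h1 h2 h3 h4 _ _ h5 => exact Charge.ne_of_lonely hG T S h1 h2 h3 h4 h5 h' hne
      | blocked h1 h2 h3 _ h4 h5 h6 => exact Charge.ne_of_blocked hG T S h1 h2 h3 h4 h5 h6 h' hne
    refine ⟨?_, hnn.2⟩
    by_cases hl' : κ l' = none
    · exact hnn.1 hl'
    · exact (h'.ne_of_selected T S h hne.symm hl').1.symm
  · exact h.ne_of_selected T S h' hne hl

lemma Charge.ne (T : SearchTree G w r par) (S : Selection G w r par κ X) {f l x y : V}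
    (h : Charge G w r par κ X f l x y) : x ≠ y := by
  have hy := h.guards T S
  cases h with
  | kept h1 _ => exact (S.runTop _ _ h1).2.2.2.1.symm
  | removed h1 _ _ => exact hy.2.1.symm
  | lonely _ _ _ _ _ h _ => exact h
  | blocked _ _ _ hyr hxy hx _ =>
    rintro rfl
    exact (T.adj x hx.1).ne hxy

/-! ### The new tree -/

/-- Either `u` is still a child of its old parent, or a leaf has been inserted between the two. -/
lemma Inserted.exists_child (T : SearchTree G w r par) (S : Selection G w r par κ X)
    (P : Inserted par κ X par') {u : V} (hu : u ≠ r) (huX : u ∉ X) :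
    ∃ v, v ≠ r ∧ par' v = par u := by
  by_cases h : ∀ l ∈ X, κ l ≠ some u
  · exact ⟨u, hu, P.other u huX h⟩
  · push Not at h
    obtain ⟨l, hl, hlu⟩ := h
    exact ⟨l, (T.guards_of_runTop (S.leaf _ _ hlu) (S.runTop _ _ hlu)).ne_root,
      P.leaf l u hl hlu⟩

lemma Inserted.exists_child_of_guards (T : SearchTree G w r par) (S : Selection G w r par κ X)
    (P : Inserted par κ X par') {l c : V} (h : Guards G r par l c) (hl : l ∉ X ∨ c ≠ par l) :
    ∃ v, v ≠ r ∧ par' v = c := by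
  obtain ⟨u, hur, huc, hul⟩ := h.2.2.1.exists_child h.2.1
  rw [← huc]
  refine P.exists_child T S hur fun huX => ?_
  obtain rfl := (S.isLeaf_of_mem huX).eq_of_anc hul
  rcases hl with hl | hl
  · exact hl huX
  · exact hl huc.symm

lemma Charge.internal (T : SearchTree G w r par) (S : Selection G w r par κ X)
    (P : Inserted par κ X par') {f l x y : V} (h : Charge G w r par κ X f l x y) :
    (x ≠ r ∧ ∃ v, v ≠ r ∧ par' v = x) ∧ (y ≠ r ∧ ∃ v, v ≠ r ∧ par' v = y) := by
  have hy := h.guards T S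
  have hlr := hy.ne_root
  cases h with
  | kept h1 h2 =>
    refine ⟨⟨?_, P.exists_child T S hlr h2⟩, hy.1, P.exists_child_of_guards T S hy (Or.inl h2)⟩
    -- The non-root vertex `y` is `par f` or a proper ancestor of it, so `par f` cannot be the root.
    intro hpr
    have hanc := (hy.2.2.1.parent hy.2.1).2
    by_cases hyp : y = par f
    · exact hy.1 (hyp.trans hpr)
    · exact (hanc.parent hyp).1 hpr
  | removed h1 h2 _ =>
    exact ⟨⟨hlr, y, hy.1, P.child _ _ h2 h1⟩, hy.1,
      P.exists_child_of_guards T S hy (Or.inr (S.runTop _ _ h1).2.2.2.1)⟩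
  | lonely _ hn _ hx _ _ _ =>
    have hl := S.notMem_of_none hn
    exact ⟨⟨hx.1, P.exists_child_of_guards T S hx (Or.inl hl)⟩, hy.1,
      P.exists_child_of_guards T S hy (Or.inl hl)⟩
  | blocked _ hn _ _ _ hx _ =>
    have hl := S.notMem_of_none hn
    exact ⟨⟨hx.1, P.exists_child_of_guards T S hx (Or.inl hl)⟩, hy.1,
      P.exists_child_of_guards T S hy (Or.inl hl)⟩

/-- A new leaf that is not an old leaf has lost all its children to insertions. An old leaf that is
still a leaf is kept if it was selected. If it was not, it is lonely when no suitable triangle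
exists, and otherwise blocked, as its run top is taken by maximality. -/
lemma Inserted.exists_charge (hG : ClawFree G) (T : SearchTree G w r par)
    (S : Selection G w r par κ X) (P : Inserted par κ X par') {f : V}
    (hdeg : ∀ p, ∃ a b, a ≠ b ∧ a ≠ p ∧ b ≠ p ∧ G.Adj f a ∧ G.Adj f b)
    (hf : ∀ v, v ≠ r → par' v ≠ f) : ∃ l x y, Charge G w r par κ X f l x y := by
  by_cases hleaf : IsLeaf r par f
  · cases hκ : κ f with
    | some c =>
      by_cases hX : f ∈ X
      · exact absurd (P.child f c hX hκ) (hf c (S.runTop _ _ hκ).1)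
      · exact ⟨_, _, _, Charge.kept hκ hX⟩
    | none =>
      by_cases hgood : ∀ c, c ≠ r → G.Adj f c → G.Adj f (par c) → c = par f
      · obtain ⟨a, b, hab, hap, hbp, hfa, hfb⟩ := hdeg (par f)
        obtain ⟨x, hx, rfl⟩ := T.exists_guard hleaf hfa hap
        obtain ⟨y, hy, rfl⟩ := T.exists_guard hleaf hfb hbp
        have hxy : x ≠ y := fun h => hab (h ▸ rfl)
        -- At most one of the two neighbours is the root; the guard below the other one is charged
        -- fully.
        by_cases hxr : par x = r
        · exact ⟨_, _, _, Charge.lonely hleaf hκ hgood hy hx hxy.symm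
            fun hyr => hab (hxr.trans hyr.symm)⟩
        · exact ⟨_, _, _, Charge.lonely hleaf hκ hgood hx hy hxy hxr⟩
      · push Not at hgood
        obtain ⟨c', hc'r, h1, h2, h3⟩ := hgood
        obtain ⟨c, hc⟩ := T.exists_runTop hleaf hc'r h1 h2 h3
        obtain ⟨m, hm⟩ := S.maximal f c hleaf hκ hc
        have hfm : f ≠ m := by rintro rfl; simp [hκ] at hm
        have hmc := S.runTop _ _ hm
        -- Below a non-root vertex two leaves cannot share a run top: one of them would be adjacent
        -- to `par (par c)`.
        have hcr : par c = r := by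
          by_contra hcr
          rcases T.adj_grandparent hG hleaf (S.leaf _ _ hm) hfm hcr hc.2.2.1 hmc.2.2.1 with h | h
          · exact (hc.2.2.2.2.resolve_left hcr) h
          · exact (hmc.2.2.2.2.resolve_left hcr) h
        obtain ⟨x, hx, hxc⟩ := T.exists_guard hleaf hc.2.1 hc.2.2.2.1
        exact ⟨_, _, _, Charge.blocked hleaf hκ hm hcr hxc hx (T.guards_of_runTop hleaf hc)⟩
  · have hall : ∀ u, u ≠ r → par u = f → u ∈ X := by
      intro u hu huf
      by_contra huX
      obtain ⟨v, hv, hvu⟩ := P.exists_child T S hu huX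
      exact hf v hv (hvu.trans huf)
    obtain ⟨u, huX, hur, rfl, hwu⟩ := S.removed f hleaf hall
    obtain ⟨c, hc⟩ := S.chosen u huX
    exact ⟨_, _, _, Charge.removed hc huX hwu⟩

lemma Inserted.rank (T : SearchTree G w r par) (S : Selection G w r par κ X)
    (P : Inserted par κ X par') : ∃ d : V → ℕ, ∀ v, v ≠ r → d (par' v) < d v := by
  classical
  obtain ⟨d, hd⟩ := T.rank
  have hcX : ∀ l c, κ l = some c → c ∉ X := fun l c h hc =>
    (T.guards_of_runTop (S.leaf _ _ h) (S.runTop _ _ h)).not_isLeaf (S.isLeaf_of_mem hc)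
  have hpX : ∀ v, v ≠ r → par v ∉ X := fun v hv h => S.isLeaf_of_mem h v hv rfl
  -- Doubling the ranks makes room for an inserted leaf between `2 * d (par c)` and `2 * d c`. The
  -- default in `getD` never matters, since `κ` is defined on `X`.
  refine ⟨fun v => if v ∈ X then 2 * d ((κ v).getD v) - 1 else 2 * d v, fun v hv => ?_⟩
  by_cases hvX : v ∈ X
  · obtain ⟨c, hc⟩ := S.chosen v hvX
    have hcr := (S.runTop _ _ hc).1
    have := hd c hcr
    simp only [P.leaf v c hvX hc, hpX c hcr, if_false, hvX, if_true, hc, Option.getD_some]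
    omega
  · by_cases h : ∀ l ∈ X, κ l ≠ some v
    · have := hd v hv
      simp only [P.other v hvX h, hpX v hv, if_false, hvX]
      omega
    · push Not at h
      obtain ⟨l, hl, hlv⟩ := h
      have := hd v hv
      simp only [P.child l v hl hlv, hl, if_true, hvX, if_false, hlv, Option.getD_some]
      omega

lemma Inserted.adj (T : SearchTree G w r par) (S : Selection G w r par κ X)
    (P : Inserted par κ X par') {v : V} (hv : v ≠ r) : G.Adj (par' v) v := by
  by_cases hvX : v ∈ X
  · obtain ⟨c, hc⟩ := S.chosen v hvX
    rw [P.leaf v c hvX hc]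
    exact (S.runTop _ _ hc).2.2.1.symm
  · by_cases h : ∀ l ∈ X, κ l ≠ some v
    · rw [P.other v hvX h]
      exact T.adj v hv
    · push Not at h
      obtain ⟨l, hl, hlv⟩ := h
      rw [P.child l v hl hlv]
      exact (S.runTop _ _ hlv).2.1

/-! ### Counting -/

/-- Full charges are injective and half charges at most two-to-one, so `w(F) ≤ w(x(F))` and `w(F) ≤
2 w(y(F))`. The two images are disjoint subsets of `I`; add the first inequality to half of the
second. -/
lemma sum_le_of_charges [DecidableEq V] {w : V → ℝ} (hw : ∀ v, 0 ≤ w v) (F I : Finset V)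
    (x y : V → V) (hx : ∀ f ∈ F, x f ∈ I ∧ w f ≤ w (x f)) (hy : ∀ f ∈ F, y f ∈ I ∧ w f ≤ w (y f))
    (hinj : Set.InjOn x F) (hxy : ∀ f ∈ F, ∀ g ∈ F, x f ≠ y g)
    (htwo : ∀ v, (F.filter fun f => y f = v).card ≤ 2) :
    3 * ∑ f ∈ F, w f ≤ 2 * ∑ v ∈ I, w v := by
  have h1 : ∑ f ∈ F, w f ≤ ∑ v ∈ F.image x, w v := by
    rw [Finset.sum_image hinj]
    exact Finset.sum_le_sum fun f hf => (hx f hf).2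
  have h2 : ∑ f ∈ F, w f ≤ 2 * ∑ v ∈ F.image y, w v := by
    calc ∑ f ∈ F, w f ≤ ∑ f ∈ F, w (y f) := Finset.sum_le_sum fun f hf => (hy f hf).2
      _ = ∑ v ∈ F.image y, ∑ f ∈ F with y f = v, w (y f) :=
          (Finset.sum_fiberwise_of_maps_to (fun f hf => Finset.mem_image_of_mem y hf) _).symm
      _ ≤ ∑ v ∈ F.image y, 2 * w v := by
          refine Finset.sum_le_sum fun v _ => ?_
          rw [Finset.sum_congr rfl fun f hf => by rw [(Finset.mem_filter.1 hf).2],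
            Finset.sum_const, nsmul_eq_mul]
          exact mul_le_mul_of_nonneg_right (by exact_mod_cast htwo v) (hw v)
      _ = 2 * ∑ v ∈ F.image y, w v := by rw [Finset.mul_sum]
  have hdisj : Disjoint (F.image x) (F.image y) := by
    rw [Finset.disjoint_left]
    intro v hv hv'
    obtain ⟨f, hf, rfl⟩ := Finset.mem_image.1 hv
    obtain ⟨g, hg, he⟩ := Finset.mem_image.1 hv'
    exact hxy f hf g hg he.symm
  have h3 : ∑ v ∈ F.image x, w v + ∑ v ∈ F.image y, w v ≤ ∑ v ∈ I, w v := by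
    rw [← Finset.sum_union hdisj]
    refine Finset.sum_le_sum_of_subset_of_nonneg ?_ fun v _ _ => hw v
    intro v hv
    rcases Finset.mem_union.1 hv with hv | hv
    · obtain ⟨f, hf, rfl⟩ := Finset.mem_image.1 hv
      exact (hx f hf).1
    · obtain ⟨f, hf, rfl⟩ := Finset.mem_image.1 hv
      exact (hy f hf).1
  linarith

open Classical in
/-- The tree obtained by the insertions has internal weight at least `3/5` of the total weight,
the root not counted. -/
theorem Inserted.internal_weight [Fintype V] (hG : ClawFree G) (T : SearchTree G w r par)
    (S : Selection G w r par κ X) (P : Inserted par κ X par') (hw : ∀ v, 0 ≤ w v)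
    (hdeg : ∀ v, v ≠ r → w v ≠ 0 → ∀ p, ∃ a b, a ≠ b ∧ a ≠ p ∧ b ≠ p ∧ G.Adj v a ∧ G.Adj v b)
    (J : Finset V) (hJ : ∀ u, u ≠ r → par' u ≠ r → par' u ∈ J) :
    3 / 5 * (∑ v, w v - w r) ≤ ∑ v ∈ J, w v := by
  set I : Finset V := Finset.univ.filter fun v => v ≠ r ∧ ∃ u, u ≠ r ∧ par' u = v with hI
  set L : Finset V := Finset.univ.filter fun v => v ≠ r ∧ ¬ ∃ u, u ≠ r ∧ par' u = v with hL
  have hsplit : ∑ v, w v - w r = ∑ v ∈ I, w v + ∑ v ∈ L, w v := by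
    rw [← Finset.sum_erase_eq_sub (Finset.mem_univ r), hI, hL,
      ← Finset.sum_filter_add_sum_filter_not (Finset.univ.erase r)
        (fun v => ∃ u, u ≠ r ∧ par' u = v)]
    congr 1 <;> refine Finset.sum_congr ?_ fun _ _ => rfl <;> ext v <;> simp
  -- Leaves of weight zero may have too few neighbours to charge, and they contribute nothing.
  set F : Finset V := L.filter fun v => w v ≠ 0 with hF
  have hLF : ∑ v ∈ F, w v = ∑ v ∈ L, w v := Finset.sum_filter_ne_zero L
  have hch : ∀ f ∈ F, ∃ l x y, Charge G w r par κ X f l x y := by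
    intro f hf
    obtain ⟨hfL, hfw⟩ := Finset.mem_filter.1 hf
    have hf' := (Finset.mem_filter.1 hfL).2
    refine P.exists_charge hG T S (hdeg f hf'.1 hfw) fun v hv hvf => hf'.2 ⟨v, hv, hvf⟩
  have hch' : ∀ f, ∃ l x y, f ∈ F → Charge G w r par κ X f l x y := by
    intro f
    by_cases hf : f ∈ F
    · obtain ⟨l, x, y, h⟩ := hch f hf
      exact ⟨l, x, y, fun _ => h⟩
    · exact ⟨f, f, f, fun h => absurd h hf⟩
  choose l x y hc using hch'
  have hlne : ∀ f ∈ F, ∀ g ∈ F, f ≠ g → l f ≠ l g := fun f hf g hg hfg h =>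
    hfg ((hc f hf).unique S (h ▸ hc g hg))
  have hmain := sum_le_of_charges hw F I x y
    (fun f hf => ⟨Finset.mem_filter.2 ⟨Finset.mem_univ _, ((hc f hf).internal T S P).1⟩,
      ((hc f hf).weight_le T S).1⟩)
    (fun f hf => ⟨Finset.mem_filter.2 ⟨Finset.mem_univ _, ((hc f hf).internal T S P).2⟩,
      ((hc f hf).weight_le T S).2⟩)
    (fun f hf g hg h => by
      by_contra hfg
      exact ((hc f hf).disjoint hG T S (hc g hg) (hlne f hf g hg hfg)).1 h)
    (fun f hf g hg => by
      by_cases hfg : f = g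
      · subst hfg; exact (hc f hf).ne T S
      · exact ((hc f hf).disjoint hG T S (hc g hg) (hlne f hf g hg hfg)).2)
    -- A half-charged vertex guards each old leaf it is charged for, so three charges would put
    -- three leaves next to its parent.
    (fun v => by
      by_contra hcon
      obtain ⟨a, b, c, ha, hb, hcc, hab, hac, hbc⟩ := Finset.two_lt_card_iff.1 (not_le.1 hcon)
      rw [Finset.mem_filter] at ha hb hcc
      have hga := (hc a ha.1).guards T S
      have hgb := (hc b hb.1).guards T S
      have hgc := (hc c hcc.1).guards T S
      rw [ha.2] at hga
      rw [hb.2] at hgb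
      rw [hcc.2] at hgc
      exact T.three_leaves hG ((hc a ha.1).isLeaf S) ((hc b hb.1).isLeaf S)
        ((hc c hcc.1).isLeaf S) hga.2.2.2 hgb.2.2.2 hgc.2.2.2 (hlne a ha.1 b hb.1 hab)
        (hlne a ha.1 c hcc.1 hac) (hlne b hb.1 c hcc.1 hbc))
  have hIJ : ∑ v ∈ I, w v ≤ ∑ v ∈ J, w v := by
    refine Finset.sum_le_sum_of_subset_of_nonneg (fun v hv => ?_) fun v _ _ => hw v
    obtain ⟨hvr, u, hu, rfl⟩ := (Finset.mem_filter.1 hv).2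
    exact hJ u hu hvr
  rw [hsplit, ← hLF]
  linarith

end Charging

/-! ### Reasoning about programs -/

section Machine

@[simp] lemma Mem.iset_ireg (σ : Mem) (x k y : ℕ) :
    (σ.iset x k).ireg y = if y = x then k else σ.ireg y := by
  simp [Mem.iset, Function.update_apply]

@[simp] lemma Mem.iset_iarr (σ : Mem) (x k : ℕ) : (σ.iset x k).iarr = σ.iarr := rfl

@[simp] lemma Mem.iset_warr (σ : Mem) (x k : ℕ) : (σ.iset x k).warr = σ.warr := rfl

@[simp] lemma Mem.istore_ireg (σ : Mem) (a i k : ℕ) : (σ.istore a i k).ireg = σ.ireg := rfl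

lemma Mem.istore_iarr (σ : Mem) (a i k b j : ℕ) :
    (σ.istore a i k).iarr b j = if b = a ∧ j = i then k else σ.iarr b j := by
  by_cases h : b = a
  · subst h; simp [Mem.istore, Function.update_apply]
  · simp [Mem.istore, h]

@[simp] lemma Mem.istore_iarr_self (σ : Mem) (a i k j : ℕ) :
    (σ.istore a i k).iarr a j = if j = i then k else σ.iarr a j := by
  simp [Mem.istore_iarr]

@[simp] lemma Mem.istore_iarr_of_ne (σ : Mem) (a i k b : ℕ) (h : b ≠ a) :
    (σ.istore a i k).iarr b = σ.iarr b := by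
  simp [Mem.istore, h]

@[simp] lemma Mem.istore_warr (σ : Mem) (a i k : ℕ) : (σ.istore a i k).warr = σ.warr := rfl

@[simp] lemma Mem.wstore_ireg (σ : Mem) (a i : ℕ) (q : ℝ) :
    (σ.wstore a i q).ireg = σ.ireg := rfl

@[simp] lemma Mem.wstore_iarr (σ : Mem) (a i : ℕ) (q : ℝ) :
    (σ.wstore a i q).iarr = σ.iarr := rfl

@[simp] lemma Mem.wstore_warr_self (σ : Mem) (a i : ℕ) (q : ℝ) (j : ℕ) :
    (σ.wstore a i q).warr a j = if j = i then q else σ.warr a j := by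
  simp [Mem.wstore, Function.update_apply]

@[simp] lemma Mem.wstore_warr_of_ne (σ : Mem) (a i : ℕ) (q : ℝ) (b : ℕ) (h : b ≠ a) :
    (σ.wstore a i q).warr b = σ.warr b := by
  simp [Mem.wstore, h]

def Program.LoopFree : Program → Prop
  | .seq p q => p.LoopFree ∧ q.LoopFree
  | .cond _ p q => p.LoopFree ∧ q.LoopFree
  | .loop _ _ => False
  | _ => True

open Classical in
/-- The effect of a loop-free program. -/
noncomputable def Program.run : Program → Mem → Mem
  | .skip, σ => σ
  | .iset x e, σ => σ.iset x (e.eval σ)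
  | .istore a i e, σ => σ.istore a (i.eval σ) (e.eval σ)
  | .wset x e, σ => σ.wset x (e.eval σ)
  | .wstore a i e, σ => σ.wstore a (i.eval σ) (e.eval σ)
  | .seq p q, σ => q.run (p.run σ)
  | .cond t p q, σ => if t.Holds σ then p.run σ else q.run σ
  | .loop _ _, σ => σ

/-- An upper bound for the number of steps of a loop-free program. -/
def Program.maxCost : Program → ℕ
  | .skip => 1
  | .iset _ e => e.cost + 1
  | .istore _ i e => i.cost + e.cost + 1
  | .wset _ e => e.cost + 1
  | .wstore _ i e => i.cost + e.cost + 1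
  | .seq p q => p.maxCost + q.maxCost
  | .cond t p q => t.cost + max p.maxCost q.maxCost
  | .loop _ _ => 0

/-- Started in `σ`, the program `p` halts after at most `b` steps in a memory that satisfies
`Q`. -/
def Runs (p : Program) (σ : Mem) (b : ℕ) (Q : Mem → Prop) : Prop :=
  ∃ τ t, Exec p σ τ t ∧ t ≤ b ∧ Q τ

lemma Program.LoopFree.exec {p : Program} (hp : p.LoopFree) (σ : Mem) :
    ∃ t ≤ p.maxCost, Exec p σ (p.run σ) t := by
  induction p generalizing σ with
  | skip => exact ⟨_, le_rfl, .skip σ⟩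
  | iset x e => exact ⟨_, le_rfl, .iset σ x e⟩
  | istore a i e => exact ⟨_, le_rfl, .istore σ a i e⟩
  | wset x e => exact ⟨_, le_rfl, .wset σ x e⟩
  | wstore a i e => exact ⟨_, le_rfl, .wstore σ a i e⟩
  | seq p q ihp ihq =>
    obtain ⟨s, hs, h1⟩ := ihp hp.1 σ
    obtain ⟨t, ht, h2⟩ := ihq hp.2 (p.run σ)
    exact ⟨_, add_le_add hs ht, h1.seq h2⟩
  | cond b p q ihp ihq =>
    by_cases hb : b.Holds σ
    · obtain ⟨s, hs, h1⟩ := ihp hp.1 σ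
      refine ⟨_, Nat.add_le_add_left (hs.trans (le_max_left _ _)) _, ?_⟩
      rw [Program.run, if_pos hb]
      exact .condTrue hb h1
    · obtain ⟨s, hs, h1⟩ := ihq hp.2 σ
      refine ⟨_, Nat.add_le_add_left (hs.trans (le_max_right _ _)) _, ?_⟩
      rw [Program.run, if_neg hb]
      exact .condFalse hb h1
  | loop b p _ => exact hp.elim

lemma Runs.of_loopFree {p : Program} {σ : Mem} {b : ℕ} {Q : Mem → Prop} (hp : p.LoopFree)
    (hb : p.maxCost ≤ b) (hQ : Q (p.run σ)) : Runs p σ b Q := by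
  obtain ⟨t, ht, h⟩ := hp.exec σ
  exact ⟨_, t, h, ht.trans hb, hQ⟩

lemma Runs.mono {p : Program} {σ : Mem} {b c : ℕ} {Q R : Mem → Prop} (h : Runs p σ b Q)
    (hbc : b ≤ c) (hQR : ∀ τ, Q τ → R τ) : Runs p σ c R := by
  obtain ⟨τ, t, h1, h2, h3⟩ := h
  exact ⟨τ, t, h1, h2.trans hbc, hQR τ h3⟩

lemma Runs.seq {p q : Program} {σ : Mem} {b c : ℕ} {Q R : Mem → Prop} (hp : Runs p σ b Q)
    (hq : ∀ τ, Q τ → Runs q τ c R) : Runs (.seq p q) σ (b + c) R := by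
  obtain ⟨τ, s, h1, h2, h3⟩ := hp
  obtain ⟨υ, t, h4, h5, h6⟩ := hq τ h3
  exact ⟨υ, _, h1.seq h4, add_le_add h2 h5, h6⟩

lemma Runs.cond {p q : Program} {t : Test} {σ : Mem} {b : ℕ} {Q : Mem → Prop}
    (hp : t.Holds σ → Runs p σ b Q) (hq : ¬ t.Holds σ → Runs q σ b Q) :
    Runs (.cond t p q) σ (t.cost + b) Q := by
  by_cases ht : t.Holds σ
  · obtain ⟨τ, s, h1, h2, h3⟩ := hp ht
    exact ⟨τ, _, .condTrue ht h1, Nat.add_le_add_left h2 _, h3⟩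
  · obtain ⟨τ, s, h1, h2, h3⟩ := hq ht
    exact ⟨τ, _, .condFalse ht h1, Nat.add_le_add_left h2 _, h3⟩

lemma Test.cost_pos (t : Test) : 0 < t.cost := by
  cases t <;> simp [Test.cost]

/-- A loop whose invariant carries a bound for the remaining number of steps. -/
lemma Runs.loop {p : Program} {t : Test} {Q : Mem → Prop} (Inv : ℕ → Mem → Prop)
    (hstep : ∀ b σ, Inv b σ → t.Holds σ →
      ∃ c, Runs p σ c fun τ => ∃ b', Inv b' τ ∧ t.cost + c + b' ≤ b)
    (hend : ∀ b σ, Inv b σ → ¬ t.Holds σ → Q σ) {b : ℕ} {σ : Mem} (h : Inv b σ) :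
    Runs (.loop t p) σ (b + t.cost) Q := by
  induction b using Nat.strong_induction_on generalizing σ with
  | _ b ih =>
    by_cases ht : t.Holds σ
    · obtain ⟨c, τ, s, h1, h2, b', h3, h4⟩ := hstep b σ h ht
      have := t.cost_pos
      obtain ⟨υ, u, h5, h6, h7⟩ := ih b' (by omega) h3
      exact ⟨υ, _, .loopTrue ht h1 h5, by omega, h7⟩
    · exact ⟨σ, _, .loopFalse ht, by omega, hend b σ h ht⟩

/-- Run `body` with the register `i` counting up to the value of the register `e`. -/
def forLoop (i e : ℕ) (body : Program) : Program :=
  .loop (.ilt (.reg i) (.reg e)) (.seq body (.iset i (.succ (.reg i))))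

/-- The 6 pays for a test and an increment, three steps each; the final 3 is the failing test. -/
lemma Runs.forLoop {i e lo hi : ℕ} {body : Program} {σ : Mem} (Inv : ℕ → Mem → Prop) (K : ℕ → ℕ)
    (hle : lo ≤ hi) (hreg : ∀ k σ, Inv k σ → σ.ireg i = k ∧ σ.ireg e = hi)
    (hstep : ∀ k σ, lo ≤ k → k < hi → Inv k σ →
      Runs body σ (K k) fun τ => τ.ireg i = k ∧ Inv (k + 1) (τ.iset i (k + 1)))
    (h : Inv lo σ) :
    Runs (forLoop i e body) σ (∑ k ∈ Finset.Ico lo hi, (K k + 6) + 3) (Inv hi) := by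
  have key := Runs.loop (p := .seq body (.iset i (.succ (.reg i))))
    (t := .ilt (.reg i) (.reg e)) (Q := Inv hi)
    (fun b σ => ∃ k, lo ≤ k ∧ k ≤ hi ∧ Inv k σ ∧ b = ∑ j ∈ Finset.Ico k hi, (K j + 6))
    ?_ ?_ ⟨lo, le_rfl, hle, h, rfl⟩
  · exact key
  · rintro b σ ⟨k, h1, h2, h3, rfl⟩ ht
    obtain ⟨hi1, he1⟩ := hreg k σ h3
    have hk : k < hi := by
      simpa [Test.Holds, IExp.eval, hi1, he1] using ht
    refine ⟨K k + 3, (hstep k σ h1 hk h3).seq fun τ hτ => ?_⟩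
    refine Runs.of_loopFree trivial le_rfl ⟨_, ⟨k + 1, by omega, hk, ?_, rfl⟩, ?_⟩
    · simpa [Program.run, IExp.eval, hτ.1] using hτ.2
    · rw [Finset.sum_eq_sum_Ico_succ_bot hk]
      simp only [Test.cost, IExp.cost]
      omega
  · rintro b σ ⟨k, h1, h2, h3, rfl⟩ ht
    obtain ⟨hi1, he1⟩ := hreg k σ h3
    have hk : ¬ k < hi := by
      simpa [Test.Holds, IExp.eval, hi1, he1] using ht
    obtain rfl : k = hi := by omega
    exact h3

/-- Run `body` with register `5` ranging over the positions of the neighbours of the vertex in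
register `x`. -/
def scan (x : ℕ) (body : Program) : Program :=
  .seq (.seq (.iset 5 (.arr 0 (.reg x))) (.iset 6 (.arr 0 (.succ (.reg x)))))
    (forLoop 5 6 body)

/-- Of the 10 additional steps, 7 load the two ends of the list and 3 are the last test of the loop.
-/
lemma Runs.scan {x lo hi B : ℕ} {body : Program} {σ : Mem} (Inv : ℕ → Mem → Prop)
    (hx5 : x ≠ 5) (hlo : σ.iarr 0 (σ.ireg x) = lo) (hhi : σ.iarr 0 (σ.ireg x + 1) = hi)
    (hle : lo ≤ hi) (hreg : ∀ k σ, Inv k σ → σ.ireg 5 = k ∧ σ.ireg 6 = hi)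
    (hstep : ∀ k σ, lo ≤ k → k < hi → Inv k σ →
      Runs body σ B fun τ => τ.ireg 5 = k ∧ Inv (k + 1) (τ.iset 5 (k + 1)))
    (h : Inv lo ((σ.iset 5 lo).iset 6 hi)) :
    Runs (scan x body) σ ((hi - lo) * (B + 6) + 10) (Inv hi) := by
  have h1 : Runs (.seq (.iset 5 (.arr 0 (.reg x))) (.iset 6 (.arr 0 (.succ (.reg x))))) σ 7
      (Inv lo) := by
    refine Runs.of_loopFree ⟨trivial, trivial⟩ le_rfl ?_
    simpa [Program.run, IExp.eval, hx5, hlo, hhi] using h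
  refine (h1.seq fun τ hτ => Runs.forLoop Inv (fun _ => B) hle hreg hstep hτ).mono ?_ fun _ => id
  simp
  omega

end Machine

/-! ### Adjacency arrays -/

section Adjacency

variable {n : ℕ} {G : SimpleGraph (Fin n)} {off adj : ℕ → ℕ}

lemma IsAdjacencyArray.off_le_last (h : IsAdjacencyArray G off adj) {k : ℕ} (hk : k ≤ n) :
    off k ≤ off n := by
  induction hk using Nat.decreasingInduction with
  | self => exact le_rfl
  | of_succ k hk ih => exact (h.off_le ⟨k, hk⟩).trans ih

lemma IsAdjacencyArray.exists_neighbor (h : IsAdjacencyArray G off adj) {v : Fin n} {i : ℕ}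
    (h1 : off v ≤ i) (h2 : i < off (v + 1)) : ∃ u : Fin n, adj i = u ∧ G.Adj v u := by
  have hlt : adj i < n := h.adj_lt i (h2.trans_le (h.off_le_last v.2))
  exact ⟨⟨adj i, hlt⟩, rfl, (h.adj_iff v ⟨adj i, hlt⟩).2 ⟨i, h1, h2, rfl⟩⟩

open Classical in
lemma IsAdjacencyArray.degree_eq (h : IsAdjacencyArray G off adj) (v : Fin n) :
    off (v + 1) - off v = G.degree v := by
  rw [← Nat.card_Ico, ← SimpleGraph.card_neighborFinset_eq_degree,
    ← Finset.card_image_of_injOn (s := Finset.Ico (off v) (off (v + 1))) (f := adj)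
      (by simpa using h.adj_inj v),
    ← Finset.card_image_of_injective (G.neighborFinset v) Fin.val_injective]
  congr 1
  ext k
  simp only [Finset.mem_image, Finset.mem_Ico, SimpleGraph.mem_neighborFinset]
  constructor
  · rintro ⟨i, ⟨h1, h2⟩, rfl⟩
    obtain ⟨u, hu, hadj⟩ := h.exists_neighbor h1 h2
    exact ⟨u, hadj, hu.symm⟩
  · rintro ⟨u, hu, rfl⟩
    obtain ⟨i, h1, h2, h3⟩ := (h.adj_iff v u).1 hu
    exact ⟨i, ⟨h1, h2⟩, h3⟩

end Adjacency

/-! ### Weights and root -/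

open Classical in
/-- The weights used by the algorithm: vertices of degree one, which are never internal, get
weight `0`. -/
noncomputable def innerWeight {n : ℕ} (G : SimpleGraph (Fin n)) (w : Fin n → ℝ) (v : Fin n) : ℝ :=
  if G.degree v = 1 then 0 else w v

/-- Degree one is recognised by consecutive offsets that differ by one. Register 3 is initially 0,
so vertex 0 is the first candidate and is first compared with itself. -/
def weightBody : Program :=
  .seq
    (.cond (.ieq (.arr 0 (.succ (.reg 2))) (.succ (.arr 0 (.reg 2))))
      (.wstore 1 (.reg 2) .zero)
      (.wstore 1 (.reg 2) (.arr 0 (.reg 2))))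
    (.cond (.wlt (.arr 1 (.reg 2)) (.arr 1 (.reg 3))) (.iset 3 (.reg 2)) .skip)

/-- Compute the inner weights (weight array `1`) and a vertex of minimum inner weight
(register `3`). -/
def weightPhase : Program := forLoop 2 0 weightBody

structure WeightInv {n : ℕ} (G : SimpleGraph (Fin n)) (w : Fin n → ℝ) (off adj : ℕ → ℕ) (k : ℕ)
    (σ : Mem) : Prop where
  counter : σ.ireg 2 = k
  size : σ.ireg 0 = n
  out : σ.ireg 1 = 0
  arrays : σ.iarr = (inputMem off adj w).iarr
  input : ∀ v : Fin n, σ.warr 0 v = w v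
  weight : ∀ v : Fin n, (v : ℕ) < k → σ.warr 1 v = innerWeight G w v
  root : (k = 0 ∧ σ.ireg 3 = 0) ∨ ∃ r : Fin n, (r : ℕ) < k ∧ σ.ireg 3 = r ∧
    ∀ v : Fin n, (v : ℕ) < k → innerWeight G w r ≤ innerWeight G w v

lemma weightPhase_runs {n : ℕ} {G : SimpleGraph (Fin n)} {off adj : ℕ → ℕ}
    (h : IsAdjacencyArray G off adj) (w : Fin n → ℝ) :
    Runs weightPhase (inputMem off adj w) (n * (weightBody.maxCost + 6) + 3)
      (WeightInv G w off adj n) := by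
  have := Runs.forLoop (i := 2) (e := 0) (lo := 0) (hi := n) (body := weightBody)
    (σ := inputMem off adj w) (WeightInv G w off adj) (fun _ => weightBody.maxCost)
    (Nat.zero_le n) (fun k σ h => ⟨h.counter, h.size⟩) ?_ ?_
  · simpa [weightPhase] using this
  · intro k σ _ hk hI
    refine Runs.of_loopFree (by simp [weightBody, Program.LoopFree]) le_rfl ?_
    have harr0 : σ.iarr 0 = off := by simp [hI.arrays, inputMem]
    have hdeg := h.degree_eq ⟨k, hk⟩
    have hle := h.off_le ⟨k, hk⟩
    have hin := hI.input ⟨k, hk⟩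
    simp only at hdeg hle hin
    set τ := (if off (k + 1) = off k + 1 then σ.wstore 1 k 0 else σ.wstore 1 k (w ⟨k, hk⟩)) with hτ
    have hiw : innerWeight G w ⟨k, hk⟩ = if off (k + 1) = off k + 1 then 0 else w ⟨k, hk⟩ := by
      rw [innerWeight]
      refine if_congr ?_ rfl rfl
      rw [← hdeg]
      omega
    have e1 : τ.ireg = σ.ireg := by rw [hτ]; split_ifs <;> rfl
    have e2 : τ.iarr = σ.iarr := by rw [hτ]; split_ifs <;> rfl
    have e3 : ∀ j, τ.warr 0 j = σ.warr 0 j := by intro j; rw [hτ]; split_ifs <;> simp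
    have e4 : ∀ j, τ.warr 1 j = if j = k then innerWeight G w ⟨k, hk⟩ else σ.warr 1 j := by
      intro j
      rw [hτ, hiw]
      split_ifs <;> simp_all
    have hrun : weightBody.run σ =
        if τ.warr 1 k < τ.warr 1 (τ.ireg 3) then τ.iset 3 k else τ := by
      simp [weightBody, Program.run, Test.Holds, IExp.eval, WExp.eval, hI.counter, harr0, hin,
        ← hτ, e1]
    have hnew : ∃ r : Fin n, (r : ℕ) < k + 1 ∧ (weightBody.run σ).ireg 3 = r ∧
        ∀ v : Fin n, (v : ℕ) < k + 1 → innerWeight G w r ≤ innerWeight G w v := by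
      rcases hI.root with ⟨rfl, h3⟩ | ⟨r, hr, h3, hmin⟩
      · refine ⟨⟨0, hk⟩, by simp, ?_, fun v hv => ?_⟩
        · rw [hrun]; split_ifs <;> simp [e1, h3]
        · have : v = ⟨0, hk⟩ := by ext; simp; omega
          rw [this]
      · have hrk : (r : ℕ) ≠ k := hr.ne
        have hr1 := hI.weight r hr
        have hcase : ∀ v : Fin n, (v : ℕ) < k + 1 → (v : ℕ) < k ∨ v = ⟨k, hk⟩ := by
          intro v hv
          rcases Nat.lt_succ_iff_lt_or_eq.1 hv with h | h
          · exact Or.inl h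
          · exact Or.inr (Fin.ext h)
        by_cases hlt : innerWeight G w ⟨k, hk⟩ < innerWeight G w r
        · refine ⟨⟨k, hk⟩, by simp, ?_, fun v hv => ?_⟩
          · rw [hrun, if_pos (by simpa [e1, e4, h3, hrk, hr1] using hlt)]; simp
          · rcases hcase v hv with h | rfl
            · exact hlt.le.trans (hmin v h)
            · exact le_rfl
        · refine ⟨r, by omega, ?_, fun v hv => ?_⟩
          · rw [hrun, if_neg (by simpa [e1, e4, h3, hrk, hr1] using hlt), e1, h3]
          · rcases hcase v hv with h | rfl
            · exact hmin v h
            · exact not_lt.1 hlt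
    have f1 : ∀ y, y ≠ 3 → (weightBody.run σ).ireg y = σ.ireg y := by
      intro y hy; rw [hrun]; split_ifs <;> simp [e1, hy]
    have f2 : (weightBody.run σ).iarr = σ.iarr := by rw [hrun]; split_ifs <;> simp [e2]
    have f3 : (weightBody.run σ).warr = τ.warr := by rw [hrun]; split_ifs <;> simp
    refine ⟨by rw [f1 2 (by norm_num), hI.counter], ?_⟩
    refine ⟨by simp, ?_, ?_, ?_, ?_, ?_, Or.inr ?_⟩
    · simp [f1, hI.size]
    · simp [f1, hI.out]
    · simp [f2, hI.arrays]
    · intro v; simp [f3, e3, hI.input]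
    · intro v hv
      simp only [Mem.iset_warr, f3, e4]
      split_ifs with hvk
      · congr 1; exact Fin.ext hvk.symm
      · exact hI.weight v (by omega)
    · obtain ⟨r, h1, h2, h3⟩ := hnew
      exact ⟨r, h1, by simpa using h2, h3⟩
  · refine ⟨by simp [inputMem], by simp [inputMem], by simp [inputMem], rfl, ?_, ?_, ?_⟩
    · intro v; simp [inputMem]
    · intro v hv; omega
    · exact Or.inl ⟨rfl, by simp [inputMem]⟩

/-! ### Depth-first search -/

section Search

/-- Number of steps left for depth-first search, when a visit of `x` takes `K x` steps. -/
noncomputable def searchPotential {n : ℕ} (K : Fin n → ℕ) (s : List (Fin n)) (vis : Set (Fin n))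
    (E : Set (Fin n × Fin n)) : ℕ := by
  classical
  exact ∑ x, (if x ∈ vis ∧ x ∉ s then 0 else 3 - {y | (x, y) ∈ E}.ncard) * K x

variable {n : ℕ} {G : SimpleGraph (Fin n)} {wt : Fin n → ℝ} {r : Fin n}

lemma SearchInv.ncard_le {s : List (Fin n)} {vis : Set (Fin n)} {E : Set (Fin n × Fin n)}
    (h : SearchInv G wt r s vis E) (hG : ClawFree G) (x : Fin n) :
    {y | (x, y) ∈ E}.ncard ≤ 2 := by
  have h1 := h.isBinary hG x
  rw [← Set.Finite.cast_ncard_eq (Set.toFinite _)] at h1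
  exact_mod_cast h1

lemma searchPotential_le (K : Fin n → ℕ) (s : List (Fin n)) (vis : Set (Fin n))
    (E : Set (Fin n × Fin n)) : searchPotential K s vis E ≤ 3 * ∑ x, K x := by
  classical
  rw [searchPotential, Finset.mul_sum]
  refine Finset.sum_le_sum fun x _ => Nat.mul_le_mul_right _ ?_
  split_ifs <;> omega

lemma ncard_children_insert {x y : Fin n} {E : Set (Fin n × Fin n)} (h : (x, y) ∉ E) (z : Fin n) :
    {u | (z, u) ∈ insert (x, y) E}.ncard = {u | (z, u) ∈ E}.ncard + if z = x then 1 else 0 := by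
  split_ifs with hz
  · subst hz
    rw [← Set.ncard_insert_of_notMem (a := y) (s := {u | (z, u) ∈ E}) h]
    congr 1
    ext u
    simp
  · congr 1
    ext u
    simp [hz]

/-- The new child lowers the factor of `x` by one; `y` becomes visited but stays unfinished, so its
factor does not change. -/
lemma searchPotential_advance (hG : ClawFree G) (K : Fin n → ℕ) {x y : Fin n}
    {s : List (Fin n)} {vis : Set (Fin n)} {E : Set (Fin n × Fin n)}
    (h : SearchInv G wt r (x :: s) vis E) (hy : y ∉ vis)
    (h' : SearchInv G wt r (y :: x :: s) (insert y vis) (insert (x, y) E)) :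
    searchPotential K (y :: x :: s) (insert y vis) (insert (x, y) E) + K x ≤
      searchPotential K (x :: s) vis E := by
  classical
  have hxy : (x, y) ∉ E := fun hxy => hy (h.child_vis _ _ hxy)
  have hK : K x = ∑ z, if z = x then K z else 0 := by simp
  rw [searchPotential, searchPotential, hK, ← Finset.sum_add_distrib]
  refine Finset.sum_le_sum fun z _ => ?_
  have h2 := h'.ncard_le hG z
  rw [ncard_children_insert hxy] at h2 ⊢
  by_cases hzx : z = x
  · subst hzx
    simp only [if_true] at h2 ⊢
    simp only [List.mem_cons, true_or, or_true, not_true, and_false, if_false]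
    -- The subtraction is not truncated: even with the new child there are at most two.
    rw [show 3 - {u | (z, u) ∈ E}.ncard = 3 - ({u | (z, u) ∈ E}.ncard + 1) + 1 by omega,
      Nat.add_mul, one_mul]
  · by_cases hzy : z = y
    · subst hzy
      simp [hzx, hy]
    · simp [hzx, hzy]

/-- The finished vertex gives up its whole remaining factor, which is at least one because it has at
most two children. -/
lemma searchPotential_backtrack (hG : ClawFree G) (K : Fin n → ℕ) {x : Fin n}
    {s : List (Fin n)} {vis : Set (Fin n)} {E : Set (Fin n × Fin n)}
    (h : SearchInv G wt r (x :: s) vis E) :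
    searchPotential K s vis E + K x ≤ searchPotential K (x :: s) vis E := by
  classical
  have hK : K x = ∑ z, if z = x then K z else 0 := by simp
  rw [searchPotential, searchPotential, hK, ← Finset.sum_add_distrib]
  refine Finset.sum_le_sum fun z _ => ?_
  have h2 := h.ncard_le hG z
  by_cases hzx : z = x
  · subst hzx
    have hz : z ∈ vis := h.stack_vis z (by simp)
    have hzs : z ∉ s := (List.nodup_cons.1 h.nodup).1
    simp only [hz, hzs, not_false_eq_true, and_self, if_true, List.mem_cons, true_or, not_true,
      and_false, if_false, zero_mul, zero_add]
    exact Nat.le_mul_of_pos_left _ (by omega)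
  · simp [hzx]

/-- The current vertex; `n` if the search is completed. -/
def top {n : ℕ} : List (Fin n) → ℕ
  | [] => n
  | x :: _ => x

/-- The memory represents the configuration `(s, vis, E)` of the search: index array `4` holds
the successors of the parents (`0` for non-visited vertices, `n + 1` for the root), array `9` the
parents and array `5` the numbers of children. -/
structure SearchMem (off adj : ℕ → ℕ) (wt : Fin n → ℝ) (r : Fin n) (s : List (Fin n))
    (vis : Set (Fin n)) (E : Set (Fin n × Fin n)) (σ : Mem) : Prop where
  size : σ.ireg 0 = n
  out : σ.ireg 1 = 0
  root : σ.ireg 3 = r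
  off_eq : σ.iarr 0 = off
  adj_eq : σ.iarr 1 = adj
  weight : ∀ v : Fin n, σ.warr 1 v = wt v
  unvisited : ∀ v : Fin n, v ∉ vis → σ.iarr 4 v = 0
  parent : ∀ u v, (u, v) ∈ E → σ.iarr 4 v = u + 1
  root_parent : σ.iarr 4 r = n + 1
  out_parent : ∀ u v, (u, v) ∈ E → σ.iarr 9 v = u
  children : ∀ v : Fin n, σ.iarr 5 v = {y | (v, y) ∈ E}.ncard
  marks : ∀ i, σ.iarr 6 i = 0
  used : ∀ i, σ.iarr 7 i = 0
  inserted : ∀ i, σ.iarr 8 i = 0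
  current : σ.ireg 4 = top s

lemma SearchMem.parent_eq_zero {off adj : ℕ → ℕ} {s : List (Fin n)} {vis : Set (Fin n)}
    {E : Set (Fin n × Fin n)} {σ : Mem} (h : SearchMem off adj wt r s vis E σ)
    (hI : SearchInv G wt r s vis E) (v : Fin n) : σ.iarr 4 v = 0 ↔ v ∉ vis := by
  refine ⟨fun h0 hv => ?_, h.unvisited v⟩
  by_cases hvr : v = r
  · have := h.root_parent
    rw [hvr] at h0
    omega
  · obtain ⟨a, ha⟩ := hI.covered v hv hvr
    have := h.parent a v ha
    omega

/-- Register 7 equal to `n` means that there is no candidate yet. The double negation expresses "no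
candidate, or strictly heavier than the candidate". -/
def bestBody : Program :=
  .seq (.iset 8 (.arr 1 (.reg 5)))
    (.cond
      (.conj (.ieq (.arr 4 (.reg 8)) (.const 0))
        (.neg (.conj (.neg (.ieq (.reg 7) (.reg 0)))
          (.neg (.wlt (.arr 1 (.reg 7)) (.arr 1 (.reg 8)))))))
      (.iset 7 (.reg 8)) .skip)

/-- Find a non-visited neighbour of maximum weight of the current vertex (register `7`). -/
def findBest : Program := .seq (.iset 7 (.reg 0)) (scan 4 bestBody)

/-- Invariant of the search for a best neighbour of `x`. -/
structure BestInv (off adj : ℕ → ℕ) (wt : Fin n → ℝ) (vis : Set (Fin n)) (x : Fin n) (σ : Mem)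
    (k : ℕ) (τ : Mem) : Prop where
  counter : τ.ireg 5 = k
  bound : τ.ireg 6 = off (x + 1)
  iarr : τ.iarr = σ.iarr
  warr : τ.warr = σ.warr
  regs : ∀ y < 5, τ.ireg y = σ.ireg y
  best : (τ.ireg 7 = n ∧ ∀ z : Fin n, (∃ i, off x ≤ i ∧ i < k ∧ adj i = z) → z ∈ vis) ∨
    ∃ y : Fin n, τ.ireg 7 = y ∧ (∃ i, off x ≤ i ∧ i < k ∧ adj i = y) ∧ y ∉ vis ∧
      ∀ z : Fin n, (∃ i, off x ≤ i ∧ i < k ∧ adj i = z) → z ∉ vis → wt z ≤ wt y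

lemma findBest_runs {off adj : ℕ → ℕ} (hA : IsAdjacencyArray G off adj) {x : Fin n}
    {vis : Set (Fin n)} {σ : Mem} (hx : σ.ireg 4 = x) (hn : σ.ireg 0 = n)
    (h0 : σ.iarr 0 = off) (h1 : σ.iarr 1 = adj) (hw : ∀ v : Fin n, σ.warr 1 v = wt v)
    (hvis : ∀ v : Fin n, σ.iarr 4 v = 0 ↔ v ∉ vis) :
    Runs findBest σ ((off (x + 1) - off x) * (bestBody.maxCost + 6) + 12)
      (BestInv off adj wt vis x σ (off (x + 1))) := by
  have hset : Runs (.iset 7 (.reg 0)) σ 2 fun τ => τ = σ.iset 7 n :=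
    Runs.of_loopFree trivial le_rfl (by simp [Program.run, IExp.eval, hn])
  refine (hset.seq (c := (off (x + 1) - off x) * (bestBody.maxCost + 6) + 10) ?_).mono
    (by omega) fun _ => id
  rintro _ rfl
  refine Runs.scan (BestInv off adj wt vis x σ) (by norm_num) (by simp [hx, h0])
    (by simp [hx, h0]) (hA.off_le x) (fun k τ h => ⟨h.counter, h.bound⟩) ?_ ?_
  · intro k τ hlo hhi hI
    refine Runs.of_loopFree (by simp [bestBody, Program.LoopFree]) le_rfl ?_
    obtain ⟨u, hu, hadj⟩ := hA.exists_neighbor hlo hhi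
    have hτn : τ.ireg 0 = n := by rw [hI.regs 0 (by norm_num), hn]
    set c : Prop := u ∉ vis ∧ (τ.ireg 7 = n ∨ τ.warr 1 (τ.ireg 7) < wt u) with hc
    have hrun : bestBody.run τ = by
        classical exact if c then (τ.iset 8 u).iset 7 u else τ.iset 8 u := by
      classical
      simp only [bestBody, Program.run, IExp.eval, hI.counter, hI.iarr, h1, hu]
      refine if_congr ?_ (by simp) rfl
      simp [Test.Holds, IExp.eval, WExp.eval, hc, hτn, hI.iarr, hI.warr, hw, hvis]
      tauto
    have hseen : ∀ z : Fin n, (∃ i, off x ≤ i ∧ i < k + 1 ∧ adj i = z) ↔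
        (∃ i, off x ≤ i ∧ i < k ∧ adj i = z) ∨ z = u := by
      intro z
      constructor
      · rintro ⟨i, hi1, hi2, hi3⟩
        rcases Nat.lt_succ_iff_lt_or_eq.1 hi2 with h | rfl
        · exact Or.inl ⟨i, hi1, h, hi3⟩
        · exact Or.inr (Fin.ext (hi3.symm.trans hu))
      · rintro (⟨i, hi1, hi2, hi3⟩ | rfl)
        · exact ⟨i, hi1, by omega, hi3⟩
        · exact ⟨k, hlo, by omega, hu⟩
    have f1 : ∀ y, y ≠ 7 → y ≠ 8 → (bestBody.run τ).ireg y = τ.ireg y := by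
      intro y h7 h8; rw [hrun]; split_ifs <;> simp [h7, h8]
    have f2 : (bestBody.run τ).iarr = τ.iarr := by rw [hrun]; split_ifs <;> simp
    have f3 : (bestBody.run τ).warr = τ.warr := by rw [hrun]; split_ifs <;> simp
    refine ⟨by rw [f1 5 (by norm_num) (by norm_num), hI.counter], by simp, ?_, ?_, ?_, ?_, ?_⟩
    · simp [f1, hI.bound]
    · simp [f2, hI.iarr]
    · simp [f3, hI.warr]
    · intro y hy
      have h5 : y ≠ 5 := by omega
      simp [h5, f1 y (by omega) (by omega), hI.regs y hy]
    · simp only [hseen, Mem.iset_ireg]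
      rw [hrun]
      by_cases hcc : c
      · simp only [hcc, if_true]
        refine Or.inr ⟨u, by simp, Or.inr rfl, hcc.1, ?_⟩
        rintro z (hz | rfl) hzv
        · rcases hI.best with ⟨_, hb⟩ | ⟨y, hy, _, _, hb⟩
          · exact absurd (hb z hz) hzv
          · rcases hcc.2 with h | h
            · have := y.2; omega
            · rw [hy, hI.warr, hw] at h
              exact (hb z hz hzv).trans h.le
        · exact le_rfl
      · simp only [hcc, if_false]
        rcases hI.best with ⟨h7, hb⟩ | ⟨y, hy, hys, hyv, hb⟩
        · refine Or.inl ⟨by simp [h7], ?_⟩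
          rintro z (hz | rfl)
          · exact hb z hz
          · by_contra hzv
            exact hcc ⟨hzv, Or.inl h7⟩
        · refine Or.inr ⟨y, by simp [hy], Or.inl hys, hyv, ?_⟩
          rintro z (hz | rfl) hzv
          · exact hb z hz hzv
          · by_contra hlt
            refine hcc ⟨hzv, Or.inr ?_⟩
            rw [hy, hI.warr, hw]
            exact not_le.1 hlt
  · refine ⟨by simp, by simp, by simp, by simp, ?_, Or.inl ⟨by simp, ?_⟩⟩
    · intro y hy
      simp [show y ≠ 5 by omega, show y ≠ 6 by omega, show y ≠ 7 by omega]
    · rintro z ⟨i, hi1, hi2, _⟩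
      omega

/-- Parents are stored shifted by one and the root stores `n + 1`, so backtracking from the root
puts `n` into register 4, which ends the search loop. -/
def moveStep : Program :=
  .cond (.ieq (.reg 7) (.reg 0))
    (.iset 4 (.pred (.arr 4 (.reg 4))))
    (.seq (.istore 4 (.reg 7) (.succ (.reg 4)))
      (.seq (.istore 9 (.reg 7) (.reg 4))
        (.seq (.istore 5 (.reg 4) (.succ (.arr 5 (.reg 4))))
          (.iset 4 (.reg 7)))))

/-- Greedy depth-first search from the vertex in register `3`. -/
def searchPhase : Program :=
  .seq (.seq (.istore 4 (.reg 3) (.succ (.reg 0))) (.iset 4 (.reg 3)))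
    (.loop (.ilt (.reg 4) (.reg 0)) (.seq findBest moveStep))

/-- Upper bound for the number of steps of one visit of `x`. -/
def visitCost (off : ℕ → ℕ) (x : Fin n) : ℕ :=
  3 + ((off (x + 1) - off x) * (bestBody.maxCost + 6) + 12 + moveStep.maxCost)

lemma searchStep_runs (hG : ClawFree G) {off adj : ℕ → ℕ} (hA : IsAdjacencyArray G off adj)
    {x : Fin n} {s : List (Fin n)} {vis : Set (Fin n)} {E : Set (Fin n × Fin n)} {σ : Mem}
    (hD : GreedyDFS G wt r (x :: s) vis E) (hM : SearchMem off adj wt r (x :: s) vis E σ) :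
    Runs (.seq findBest moveStep) σ
      ((off (x + 1) - off x) * (bestBody.maxCost + 6) + 12 + moveStep.maxCost)
      fun τ => ∃ s' vis' E', GreedyDFS G wt r s' vis' E' ∧ SearchMem off adj wt r s' vis' E' τ ∧
        searchPotential (visitCost off) s' vis' E' + visitCost off x ≤
          searchPotential (visitCost off) (x :: s) vis E := by
  have hI := hD.inv
  refine (findBest_runs hA hM.current hM.size hM.off_eq hM.adj_eq hM.weight
    (hM.parent_eq_zero hI)).seq fun τ hτ => ?_
  refine Runs.of_loopFree (by simp [moveStep, Program.LoopFree]) le_rfl ?_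
  have r0 := (hτ.regs 0 (by norm_num)).trans hM.size
  have r1 := (hτ.regs 1 (by norm_num)).trans hM.out
  have r3 := (hτ.regs 3 (by norm_num)).trans hM.root
  have r4 : τ.ireg 4 = x := (hτ.regs 4 (by norm_num)).trans hM.current
  have ha := hτ.iarr
  have hw := hτ.warr
  rcases hτ.best with ⟨h7, hfin⟩ | ⟨y, h7, hseen, hyv, hmax⟩
  · have hall : ∀ z, G.Adj x z → z ∈ vis := fun z hz => hfin z ((hA.adj_iff x z).1 hz)
    have hrun : moveStep.run τ = τ.iset 4 (σ.iarr 4 x - 1) := by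
      simp [moveStep, Program.run, Test.Holds, IExp.eval, h7, r0, r4, ha]
    rw [hrun]
    refine ⟨s, vis, E, hD.backtrack hall, ?_, searchPotential_backtrack hG _ hI⟩
    refine ⟨by simp [r0], by simp [r1], by simp [r3], by simp [ha, hM.off_eq],
      by simp [ha, hM.adj_eq], by simp [hw, hM.weight], by simpa [ha] using hM.unvisited,
      by simpa [ha] using hM.parent, by simp [ha, hM.root_parent],
      by simpa [ha] using hM.out_parent, by simpa [ha] using hM.children,
      by simpa [ha] using hM.marks, by simpa [ha] using hM.used,
      by simpa [ha] using hM.inserted, ?_⟩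
    simp only [Mem.iset_ireg, if_true]
    cases s with
    | nil =>
      have hxr : x = r := hI.path
      rw [hxr, hM.root_parent]
      rfl
    | cons z s =>
      rw [hM.parent z x hI.path.1]
      rfl
  · have hadj : G.Adj x y := (hA.adj_iff x y).2 hseen
    have hbest : ∀ z, G.Adj x z → z ∉ vis → wt z ≤ wt y :=
      fun z hz hzv => hmax z ((hA.adj_iff x z).1 hz) hzv
    have hyn : (y : ℕ) ≠ n := y.2.ne
    have hrun : moveStep.run τ =
        (((τ.istore 4 y (x + 1)).istore 9 y x).istore 5 x (σ.iarr 5 x + 1)).iset 4 y := by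
      simp [moveStep, Program.run, Test.Holds, IExp.eval, h7, r0, r4, ha, hyn]
    have hD' := hD.advance hadj hyv hbest
    have hxyE : (x, y) ∉ E := fun h => hyv (hI.child_vis _ _ h)
    rw [hrun]
    refine ⟨_, _, _, hD', ?_, searchPotential_advance hG _ hI hyv hD'.inv⟩
    have hval : ∀ u v : Fin n, ((u : ℕ) = v) ↔ u = v := fun u v => Fin.ext_iff.symm
    refine ⟨by simp [r0], by simp [r1], by simp [r3], by simp [ha, hM.off_eq],
      by simp [ha, hM.adj_eq], by simp [hw, hM.weight], ?_, ?_, ?_, ?_, ?_,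
      by simpa [ha] using hM.marks, by simpa [ha] using hM.used,
      by simpa [ha] using hM.inserted, by simp [top]⟩
    · intro v hv
      have hvy : v ≠ y := fun h => hv (Or.inl h)
      simpa [ha, hval, hvy] using hM.unvisited v fun h => hv (Or.inr h)
    · rintro u v (huv | huv)
      · obtain ⟨rfl, rfl⟩ := Prod.mk.inj huv
        simp
      · have hvy : v ≠ y := fun h => hyv (h ▸ hI.child_vis _ _ huv)
        simpa [ha, hval, hvy] using hM.parent u v huv
    · have hry : r ≠ y := fun h => hyv (h ▸ hI.root_vis)
      simpa [ha, hval, hry] using hM.root_parent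
    · rintro u v (huv | huv)
      · obtain ⟨rfl, rfl⟩ := Prod.mk.inj huv
        simp
      · have hvy : v ≠ y := fun h => hyv (h ▸ hI.child_vis _ _ huv)
        simpa [ha, hval, hvy] using hM.out_parent u v huv
    · intro v
      rw [ncard_children_insert hxyE]
      by_cases hvx : v = x
      · subst hvx
        simp [hM.children]
      · simp [ha, hval, hvx, hM.children]

lemma searchPhase_runs (hG : ClawFree G) {off adj : ℕ → ℕ} (hA : IsAdjacencyArray G off adj)
    {w : Fin n → ℝ} {σ : Mem} (hσ : WeightInv G w off adj n σ) (hr : σ.ireg 3 = r) :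
    Runs searchPhase σ (3 * ∑ x : Fin n, visitCost off x + 11)
      fun τ => ∃ vis E, GreedyDFS G (innerWeight G w) r [] vis E ∧
        SearchMem off adj (innerWeight G w) r [] vis E τ := by
  have hstart : Runs (.seq (.istore 4 (.reg 3) (.succ (.reg 0))) (.iset 4 (.reg 3))) σ 8
      (SearchMem off adj (innerWeight G w) r [r] {r} ∅) := by
    refine Runs.of_loopFree ⟨trivial, trivial⟩ (by simp [Program.maxCost, IExp.cost]) ?_
    have hrun : (Program.seq (.istore 4 (.reg 3) (.succ (.reg 0))) (.iset 4 (.reg 3))).run σ =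
        (σ.istore 4 r (n + 1)).iset 4 r := by
      simp [Program.run, IExp.eval, hr, hσ.size]
    rw [hrun]
    refine ⟨by simp [hσ.size], by simp [hσ.out], by simp [hr], by simp [hσ.arrays, inputMem],
      by simp [hσ.arrays, inputMem], fun v => by simp [hσ.weight v v.2], ?_, by simp, by simp,
      by simp, by simp [hσ.arrays, inputMem], by simp [hσ.arrays, inputMem],
      by simp [hσ.arrays, inputMem], by simp [hσ.arrays, inputMem], by simp [top]⟩
    intro v hv
    have : (v : ℕ) ≠ r := fun h => hv (Fin.ext h)
    simp [this, hσ.arrays, inputMem]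
  refine (hstart.seq fun τ hτ => Runs.loop (Q := fun τ => ∃ vis E,
    GreedyDFS G (innerWeight G w) r [] vis E ∧ SearchMem off adj (innerWeight G w) r [] vis E τ)
    (fun b τ => ∃ s vis E, GreedyDFS G (innerWeight G w) r s vis E ∧
      SearchMem off adj (innerWeight G w) r s vis E τ ∧
      searchPotential (visitCost off) s vis E = b)
    ?_ ?_ ⟨_, _, _, .start, hτ, rfl⟩).mono ?_ fun _ => id
  · rintro b τ ⟨s, vis, E, hD, hM, rfl⟩ ht
    cases s with
    | nil => simp [Test.Holds, IExp.eval, hM.current, hM.size, top] at ht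
    | cons x s =>
      refine ⟨_, (searchStep_runs hG hA hD hM).mono le_rfl ?_⟩
      rintro υ ⟨s', vis', E', hD', hM', hle⟩
      refine ⟨_, ⟨s', vis', E', hD', hM', rfl⟩, ?_⟩
      rw [visitCost] at hle
      simp only [Test.cost, IExp.cost]
      omega
  · rintro b τ ⟨s, vis, E, hD, hM, rfl⟩ ht
    cases s with
    | nil => exact ⟨vis, E, hD, hM⟩
    | cons x s => simp [Test.Holds, IExp.eval, hM.current, hM.size, top] at ht
  · have := searchPotential_le (visitCost off) [r] {r} (∅ : Set (Fin n × Fin n))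
    simp only [Test.cost, IExp.cost]
    omega

end Search

/-! ### Selection of leaves -/

section SelectionPhase

variable {n : ℕ} {G : SimpleGraph (Fin n)} {wt : Fin n → ℝ} {r : Fin n} {par par' : Fin n → Fin n}

/-- Once all vertices are visited, each non-root vertex has exactly one parent, so the pairs come
from a function. -/
lemma SearchInv.exists_searchTree {V : Type*} {G : SimpleGraph V} {w : V → ℝ} {r : V}
    {vis : Set V} {E : Set (V × V)} (h : SearchInv G w r [] vis E) (hG : G.Connected) :
    ∃ par, E = parentPairs r par ∧ SearchTree G w r par := by
  classical
  have huniv := h.vis_eq_univ hG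
  have hvis : ∀ v, v ∈ vis := fun v => huniv ▸ Set.mem_univ v
  have hex : ∀ v, ∃ a, v ≠ r → (a, v) ∈ E := by
    intro v
    by_cases hv : v = r
    · exact ⟨r, fun h => absurd hv h⟩
    · obtain ⟨a, ha⟩ := h.covered v (hvis v) hv
      exact ⟨a, fun _ => ha⟩
  choose par hpar using hex
  have hE : E = parentPairs r par := by
    ext ⟨a, c⟩
    constructor
    · intro hac
      have hc := h.child_ne a c hac
      exact ⟨hc, h.unique _ _ _ (hpar c hc) hac⟩
    · rintro ⟨hc, hca⟩
      exact (show par c = a from hca) ▸ hpar c hc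
  refine ⟨par, hE, ⟨fun v hv => h.adj _ _ (hpar v hv), ?_, fun u v huv => ?_, ?_⟩⟩
  · obtain ⟨d, hd⟩ := h.rank
    exact ⟨d, fun v hv => hd _ _ (hpar v hv)⟩
  · exact hE ▸ h.related u (hvis u) v (hvis v) huv
  · intro c hc z hz hcz
    exact h.greedy _ c (hpar c hc) z hz (Or.inr (hE ▸ hcz))

/-- A selection in which only the leaves below `k` have been considered. -/
structure PartialSelection (G : SimpleGraph (Fin n)) (wt : Fin n → ℝ) (r : Fin n)
    (par : Fin n → Fin n) (k : ℕ) (κ : Fin n → Option (Fin n)) (X : Set (Fin n)) : Prop where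
  below : ∀ l c, κ l = some c → (l : ℕ) < k
  leaf : ∀ l c, κ l = some c → IsLeaf r par l
  runTop : ∀ l c, κ l = some c → RunTop G r par l c
  maximal : ∀ l c : Fin n, (l : ℕ) < k → IsLeaf r par l → κ l = none → RunTop G r par l c →
    ∃ m, κ m = some c
  chosen : ∀ l ∈ X, ∃ c, κ l = some c
  kept : ∀ l c, κ l = some c → l ∉ X →
    wt l ≤ wt (par l) ∧ ∀ u, u ≠ r → par u = par l → u ≠ l → u ∈ X
  removed : ∀ q, ¬ IsLeaf r par q → (∀ u, u ≠ r → par u = q → u ∈ X) →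
    ∃ u ∈ X, u ≠ r ∧ par u = q ∧ wt q ≤ wt u

/-! ### Extending a selection one leaf at a time -/

namespace PartialSelection

variable {k : ℕ} {κ : Fin n → Option (Fin n)} {X : Set (Fin n)}

lemma start : PartialSelection G wt r par 0 (fun _ => none) ∅ where
  below := by simp
  leaf := by simp
  runTop := by simp
  maximal := by simp
  chosen := by simp
  kept := by simp
  removed q hq h := by
    simp only [IsLeaf, not_forall] at hq
    obtain ⟨u, hu, huq⟩ := hq
    exact absurd (h u hu (not_not.1 huq)) (Set.notMem_empty u)

lemma toSelection (S : PartialSelection G wt r par n κ X) : Selection G wt r par κ X where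
  leaf := S.leaf
  runTop := S.runTop
  maximal l c := S.maximal l c l.2
  chosen := S.chosen
  kept := S.kept
  removed := S.removed

lemma eq_none (S : PartialSelection G wt r par k κ X) {l : Fin n} (hl : (l : ℕ) = k) :
    κ l = none := by
  cases h : κ l with
  | none => rfl
  | some c => exact absurd (S.below l c h) (by omega)

lemma skip (S : PartialSelection G wt r par k κ X) {l : Fin n} (hl : (l : ℕ) = k)
    (h : IsLeaf r par l → ∀ c, RunTop G r par l c → ∃ m, κ m = some c) :
    PartialSelection G wt r par (k + 1) κ X :=
  { S with
    below := fun m c hm => (S.below m c hm).trans (Nat.lt_succ_self k)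
    maximal := fun m c hm hleaf hn hc => by
      rcases Nat.lt_succ_iff_lt_or_eq.1 hm with hm | hm
      · exact S.maximal m c hm hleaf hn hc
      · obtain rfl : m = l := Fin.ext (hm.trans hl.symm)
        exact h hleaf c hc }

lemma update_eq {l c m b : Fin n} (h : Function.update κ l (some c) m = some b) :
    (m = l ∧ b = c) ∨ (m ≠ l ∧ κ m = some b) := by
  by_cases hm : m = l
  · subst hm
    simp only [Function.update_self, Option.some.injEq] at h
    exact Or.inl ⟨rfl, h.symm⟩
  · rw [Function.update_of_ne hm] at h
    exact Or.inr ⟨hm, h⟩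

/-- Common core of `keep` and `insert`. Since `X` only grows, the conditions established for earlier
kept leaves persist. -/
lemma choose (S : PartialSelection G wt r par k κ X) {l c : Fin n} (hl : (l : ℕ) = k)
    (hleaf : IsLeaf r par l) (hc : RunTop G r par l c) (hfree : ∀ m, κ m ≠ some c)
    {Y : Set (Fin n)} (hXY : X ⊆ Y) (hYX : Y ⊆ insert l X)
    (hkept : l ∉ Y → wt l ≤ wt (par l) ∧ ∀ u, u ≠ r → par u = par l → u ≠ l → u ∈ Y)
    (hremoved : ∀ q, ¬ IsLeaf r par q → (∀ u, u ≠ r → par u = q → u ∈ Y) →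
      ∃ u ∈ Y, u ≠ r ∧ par u = q ∧ wt q ≤ wt u) :
    PartialSelection G wt r par (k + 1) (Function.update κ l (some c)) Y where
  below m b h := by
    rcases update_eq h with ⟨rfl, -⟩ | ⟨-, h⟩
    · omega
    · exact (S.below m b h).trans (Nat.lt_succ_self k)
  leaf m b h := by
    rcases update_eq h with ⟨rfl, -⟩ | ⟨-, h⟩
    · exact hleaf
    · exact S.leaf m b h
  runTop m b h := by
    rcases update_eq h with ⟨rfl, rfl⟩ | ⟨-, h⟩
    · exact hc
    · exact S.runTop m b h
  maximal m b hm hmleaf hn hb := by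
    have hml : m ≠ l := by
      rintro rfl
      simp at hn
    have hnm : κ m = none := by rwa [Function.update_of_ne hml] at hn
    have hmk : (m : ℕ) < k := by
      have : (m : ℕ) ≠ l := fun h => hml (Fin.ext h)
      omega
    obtain ⟨m', hm'⟩ := S.maximal m b hmk hmleaf hnm hb
    refine ⟨m', ?_⟩
    rw [Function.update_of_ne, hm']
    rintro rfl
    rw [S.eq_none hl] at hm'
    cases hm'
  chosen m hm := by
    by_cases hml : m = l
    · exact ⟨c, by rw [hml, Function.update_self]⟩
    · obtain ⟨b, hb⟩ := S.chosen m ((hYX hm).resolve_left hml)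
      exact ⟨b, by rw [Function.update_of_ne hml, hb]⟩
  kept m b h hm := by
    rcases update_eq h with ⟨rfl, -⟩ | ⟨-, h⟩
    · exact hkept hm
    · obtain ⟨h1, h2⟩ := S.kept m b h fun hX => hm (hXY hX)
      exact ⟨h1, fun u hu hup hum => hXY (h2 u hu hup hum)⟩
  removed := hremoved

/-- The leaf `l` gets the edge above `c` but is not inserted. -/
lemma keep (S : PartialSelection G wt r par k κ X) {l c : Fin n} (hl : (l : ℕ) = k)
    (hleaf : IsLeaf r par l) (hc : RunTop G r par l c) (hfree : ∀ m, κ m ≠ some c)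
    (hkept : wt l ≤ wt (par l) ∧ ∀ u, u ≠ r → par u = par l → u ≠ l → u ∈ X) :
    PartialSelection G wt r par (k + 1) (Function.update κ l (some c)) X :=
  S.choose hl hleaf hc hfree subset_rfl (Set.subset_insert _ _) (fun _ => hkept) S.removed

/-- The leaf `l` is inserted into the edge above `c`. -/
lemma insert (S : PartialSelection G wt r par k κ X) {l c : Fin n} (hl : (l : ℕ) = k)
    (hleaf : IsLeaf r par l) (hc : RunTop G r par l c) (hfree : ∀ m, κ m ≠ some c) (hlr : l ≠ r)
    (h : (∃ u, u ≠ r ∧ par u = par l ∧ u ≠ l ∧ u ∉ X) ∨ wt (par l) ≤ wt l) :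
    PartialSelection G wt r par (k + 1) (Function.update κ l (some c)) (insert l X) := by
  refine S.choose hl hleaf hc hfree (Set.subset_insert _ _) subset_rfl
    (fun hl => absurd (Set.mem_insert _ _) hl) fun q hq hall => ?_
  -- Only the parent of `l` can newly have all its children inserted; then either a child outside
  -- the set contradicts this, or `l` is the required heavy child.
  by_cases hql : q = par l
  · rcases h with ⟨u, hu, hup, hul, huX⟩ | h
    · exact absurd (hall u hu (hup.trans hql.symm)) (by simp [hul, huX])
    · exact ⟨l, Set.mem_insert _ _, hlr, hql.symm, hql ▸ h⟩
  · obtain ⟨u, huX, h1, h2, h3⟩ := S.removed q hq fun u hu huq =>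
      (hall u hu huq).resolve_left (by rintro rfl; exact hql huq.symm)
    exact ⟨u, Set.mem_insert_of_mem _ huX, h1, h2, h3⟩

end PartialSelection

lemma Inserted.start : Inserted par (fun _ => none) ∅ par :=
  ⟨by simp, by simp, by simp⟩

lemma Inserted.keep {κ : Fin n → Option (Fin n)} {X : Set (Fin n)} (P : Inserted par κ X par')
    {l c : Fin n} (hl : l ∉ X) : Inserted par (Function.update κ l (some c)) X par' := by
  have hne : ∀ m ∈ X, Function.update κ l (some c) m = κ m := fun m hm =>
    Function.update_of_ne (fun h : m = l => hl (h ▸ hm)) _ _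
  refine ⟨fun m b hm h => P.leaf m b hm (hne m hm ▸ h),
    fun m b hm h => P.child m b hm (hne m hm ▸ h),
    fun v hv h => P.other v hv fun m hm => hne m hm ▸ h m hm⟩

/-- Neither `l` nor `c` has been inserted or used as an edge before, so the two redirected pointers
do not disturb earlier insertions. -/
lemma Inserted.insert {κ : Fin n → Option (Fin n)} {X : Set (Fin n)} (P : Inserted par κ X par')
    {l c : Fin n} (hlX : l ∉ X) (hlc : l ≠ c) (hcX : c ∉ X) (hl : ∀ m, κ m ≠ some l)
    (hc : ∀ m, κ m ≠ some c) :
    Inserted par (Function.update κ l (some c)) (insert l X)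
      (Function.update (Function.update par' l (par c)) c l) := by
  refine ⟨fun m b hm h => ?_, fun m b hm h => ?_, fun v hv h => ?_⟩
  · rcases PartialSelection.update_eq h with ⟨rfl, rfl⟩ | ⟨hml, h⟩
    · rw [Function.update_of_ne hlc, Function.update_self]
    · have hm := hm.resolve_left hml
      rw [Function.update_of_ne (fun h : m = c => hcX (h ▸ hm)), Function.update_of_ne hml]
      exact P.leaf m b hm h
  · rcases PartialSelection.update_eq h with ⟨rfl, rfl⟩ | ⟨hml, h⟩
    · rw [Function.update_self]
    · have hm := hm.resolve_left hml
      rw [Function.update_of_ne (fun hb : b = c => hc m (hb ▸ h)),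
        Function.update_of_ne (fun hb : b = l => hl m (hb ▸ h))]
      exact P.child m b hm h
  · have hvl : v ≠ l := fun h => hv (Or.inl h)
    have hvc : v ≠ c := by
      rintro rfl
      exact h l (Or.inl rfl) (Function.update_self _ _ _)
    rw [Function.update_of_ne hvc, Function.update_of_ne hvl]
    refine P.other v (fun h => hv (Or.inr h)) fun m hm => ?_
    have := h m (Or.inr hm)
    rwa [Function.update_of_ne (fun h : m = l => hlX (h ▸ hm))] at this

/-- The part of the memory that does not change after the search. -/
structure TreeMem (off adj : ℕ → ℕ) (wt : Fin n → ℝ) (r : Fin n) (par : Fin n → Fin n)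
    (σ : Mem) : Prop where
  size : σ.ireg 0 = n
  out : σ.ireg 1 = 0
  root : σ.ireg 3 = r
  off_eq : σ.iarr 0 = off
  adj_eq : σ.iarr 1 = adj
  weight : ∀ v : Fin n, σ.warr 1 v = wt v
  parent : ∀ v : Fin n, v ≠ r → σ.iarr 4 v = par v + 1
  root_parent : σ.iarr 4 r = n + 1
  children : ∀ v : Fin n, σ.iarr 5 v = {u | u ≠ r ∧ par u = v}.ncard

lemma TreeMem.of_eq {off adj : ℕ → ℕ} {σ τ : Mem} (h : TreeMem off adj wt r par σ)
    (hreg : ∀ y, y < 5 → y ≠ 2 → τ.ireg y = σ.ireg y) (harr : ∀ a, a < 6 → τ.iarr a = σ.iarr a)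
    (hw : τ.warr = σ.warr) : TreeMem off adj wt r par τ where
  size := by rw [hreg 0 (by norm_num) (by norm_num), h.size]
  out := by rw [hreg 1 (by norm_num) (by norm_num), h.out]
  root := by rw [hreg 3 (by norm_num) (by norm_num), h.root]
  off_eq := by rw [harr 0 (by norm_num), h.off_eq]
  adj_eq := by rw [harr 1 (by norm_num), h.adj_eq]
  weight := by rw [hw]; exact h.weight
  parent := by rw [harr 4 (by norm_num)]; exact h.parent
  root_parent := by rw [harr 4 (by norm_num)]; exact h.root_parent
  children := by rw [harr 5 (by norm_num)]; exact h.children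

lemma TreeMem.isLeaf_iff {off adj : ℕ → ℕ} {σ : Mem} (h : TreeMem off adj wt r par σ)
    (v : Fin n) : σ.iarr 5 v = 0 ↔ IsLeaf r par v := by
  rw [h.children, Set.ncard_eq_zero (Set.toFinite _), Set.eq_empty_iff_forall_notMem]
  simp [IsLeaf]

/-- Mark the neighbours of the vertex in register `2`. -/
def markBody : Program := .istore 6 (.arr 1 (.reg 5)) (.succ (.reg 2))

/-- Invariant of marking the neighbours of `l`. -/
structure MarkInv (off adj : ℕ → ℕ) (l : Fin n) (σ : Mem) (k : ℕ) (τ : Mem) : Prop where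
  counter : τ.ireg 5 = k
  bound : τ.ireg 6 = off (l + 1)
  regs : ∀ y < 5, τ.ireg y = σ.ireg y
  arrays : ∀ a, a ≠ 6 → τ.iarr a = σ.iarr a
  warr : τ.warr = σ.warr
  marked : ∀ z : Fin n, τ.iarr 6 z = l + 1 ↔ ∃ i, off l ≤ i ∧ i < k ∧ adj i = z
  le : ∀ z : Fin n, τ.iarr 6 z ≤ l + 1
  dummy : τ.iarr 6 n = 0

/-- The mark `l + 1` acts as a time stamp: older marks are at most `l`, so the array is never
cleared. -/
lemma mark_runs {off adj : ℕ → ℕ} (hA : IsAdjacencyArray G off adj) {l : Fin n} {σ : Mem}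
    (hM : TreeMem off adj wt r par σ) (hl : σ.ireg 2 = l) (hle : ∀ z : Fin n, σ.iarr 6 z ≤ l)
    (hn : σ.iarr 6 n = 0) :
    Runs (scan 2 markBody) σ ((off (l + 1) - off l) * (markBody.maxCost + 6) + 10)
      (MarkInv off adj l σ (off (l + 1))) := by
  refine Runs.scan (MarkInv off adj l σ) (by norm_num) (by simp [hl, hM.off_eq])
    (by simp [hl, hM.off_eq]) (hA.off_le l) (fun k τ h => ⟨h.counter, h.bound⟩) ?_ ?_
  · intro k τ hlo hhi hI
    refine Runs.of_loopFree trivial le_rfl ?_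
    obtain ⟨u, hu, -⟩ := hA.exists_neighbor hlo hhi
    have hrun : markBody.run τ = τ.istore 6 u (l + 1) := by
      simp [markBody, Program.run, IExp.eval, hI.counter, hI.arrays 1, hM.adj_eq, hu,
        hI.regs 2, hl]
    have hval : ∀ a b : Fin n, ((a : ℕ) = b) ↔ a = b := fun a b => Fin.ext_iff.symm
    have hun : n ≠ (u : ℕ) := u.2.ne'
    rw [hrun]
    refine ⟨by simp [hI.counter], by simp, by simp [hI.bound], ?_, ?_,
      by simp [hI.warr], ?_, ?_, ?_⟩
    · intro y hy
      simp [show y ≠ 5 by omega, hI.regs y hy]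
    · intro a ha
      simp [ha, hI.arrays a ha]
    · intro z
      simp only [Mem.iset_iarr, Mem.istore_iarr_self, hval]
      by_cases hz : z = u
      · simp only [hz, if_true, true_iff]
        exact ⟨k, hlo, by omega, hu⟩
      · simp only [hz, if_false, hI.marked]
        constructor
        · rintro ⟨i, h1, h2, h3⟩
          exact ⟨i, h1, by omega, h3⟩
        · rintro ⟨i, h1, h2, h3⟩
          refine ⟨i, h1, ?_, h3⟩
          rcases Nat.lt_succ_iff_lt_or_eq.1 h2 with h | rfl
          · exact h
          · exact absurd (Fin.ext (h3.symm.trans hu)) hz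
    · intro z
      simp only [Mem.iset_iarr, Mem.istore_iarr_self]
      split_ifs
      · exact le_rfl
      · exact hI.le z
    · simp [hun, hI.dummy]
  · refine ⟨by simp, by simp, ?_, by simp, by simp, ?_, ?_, by simp [hn]⟩
    · intro y hy
      simp [show y ≠ 5 by omega, show y ≠ 6 by omega]
    · intro z
      have := hle z
      constructor
      · intro h
        simp only [Mem.iset_iarr] at h
        omega
      · rintro ⟨i, h1, h2, -⟩
        omega
    · intro z
      have := hle z
      simp only [Mem.iset_iarr]
      omega

/-- The decoded parent of the root is `n`, whose mark stays 0. Hence the root fails the first test,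
and a child of the root passes the test that its grandparent is unmarked. -/
def selectBody : Program :=
  .seq (.seq (.iset 8 (.arr 1 (.reg 5))) (.iset 9 (.pred (.arr 4 (.reg 8)))))
    (.cond
      (.conj (.ieq (.arr 6 (.reg 9)) (.succ (.reg 2)))
        (.conj (.neg (.ieq (.arr 6 (.pred (.arr 4 (.reg 9)))) (.succ (.reg 2))))
          (.conj (.neg (.ieq (.reg 8) (.pred (.arr 4 (.reg 2)))))
            (.ieq (.arr 7 (.reg 8)) (.const 0)))))
      (.iset 7 (.reg 8)) .skip)

/-- Find the lower end of an unused edge for the leaf in register `2` (register `7`). -/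
def selectEdge : Program := .seq (.iset 7 (.reg 0)) (scan 2 selectBody)

/-- Invariant of the search for an edge for `l`. -/
structure SelectInv (G : SimpleGraph (Fin n)) (r : Fin n) (par : Fin n → Fin n)
    (off adj : ℕ → ℕ) (l : Fin n) (σ : Mem) (k : ℕ) (τ : Mem) : Prop where
  counter : τ.ireg 5 = k
  bound : τ.ireg 6 = off (l + 1)
  regs : ∀ y < 5, τ.ireg y = σ.ireg y
  iarr : τ.iarr = σ.iarr
  warr : τ.warr = σ.warr
  found : (τ.ireg 7 = n ∧ ∀ c : Fin n, (∃ i, off l ≤ i ∧ i < k ∧ adj i = c) →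
      RunTop G r par l c → σ.iarr 7 c ≠ 0) ∨
    ∃ c : Fin n, τ.ireg 7 = c ∧ RunTop G r par l c ∧ σ.iarr 7 c = 0

lemma selectEdge_runs {off adj : ℕ → ℕ} (hA : IsAdjacencyArray G off adj)
    (T : SearchTree G wt r par) {l : Fin n} (hleaf : IsLeaf r par l) {σ : Mem}
    (hM : TreeMem off adj wt r par σ) (hl : σ.ireg 2 = l)
    (hmark : ∀ z : Fin n, σ.iarr 6 z = l + 1 ↔ G.Adj l z) (hn : σ.iarr 6 n = 0) :
    Runs selectEdge σ ((off (l + 1) - off l) * (selectBody.maxCost + 6) + 12)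
      (SelectInv G r par off adj l σ (off (l + 1))) := by
  have hset : Runs (.iset 7 (.reg 0)) σ 2 fun τ => τ = σ.iset 7 n :=
    Runs.of_loopFree trivial le_rfl (by simp [Program.run, IExp.eval, hM.size])
  refine (hset.seq (c := (off (l + 1) - off l) * (selectBody.maxCost + 6) + 10) ?_).mono
    (by omega) fun _ => id
  rintro _ rfl
  refine Runs.scan (SelectInv G r par off adj l σ) (by norm_num) (by simp [hl, hM.off_eq])
    (by simp [hl, hM.off_eq]) (hA.off_le l) (fun k τ h => ⟨h.counter, h.bound⟩) ?_ ?_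
  · intro k τ hlo hhi hI
    refine Runs.of_loopFree (by simp [selectBody, Program.LoopFree]) le_rfl ?_
    obtain ⟨u, hu, hadj⟩ := hA.exists_neighbor hlo hhi
    have hval : ∀ a b : Fin n, ((a : ℕ) = b) ↔ a = b := fun a b => Fin.ext_iff.symm
    have hlr : l ≠ r := ((T.anc_of_adj_leaf hleaf hadj).parent hadj.ne').1
    have hτ2 : τ.ireg 2 = l := by rw [hI.regs 2 (by norm_num), hl]
    have hrun : selectBody.run τ = by
        classical exact if RunTop G r par l u ∧ σ.iarr 7 u = 0 then
          ((τ.iset 8 u).iset 9 (σ.iarr 4 u - 1)).iset 7 u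
          else (τ.iset 8 u).iset 9 (σ.iarr 4 u - 1) := by
      classical
      simp only [selectBody, Program.run, IExp.eval, hI.counter, hI.iarr, hM.adj_eq, hu,
        Mem.iset_ireg, if_true, Mem.iset_iarr]
      refine if_congr ?_ (by simp) rfl
      simp only [Test.Holds, IExp.eval, hτ2, hI.iarr, Mem.iset_ireg, Mem.iset_iarr, if_true]
      by_cases hur : u = r
      · subst hur
        simp [hM.root_parent, hn, RunTop]
      · by_cases hpr : par u = r
        · simp [hM.parent u hur, hM.parent l hlr, hmark, RunTop, hur, hadj, hval, hpr,
            hM.root_parent, hn]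
          tauto
        · simp [hM.parent u hur, hM.parent l hlr, hmark, RunTop, hur, hadj, hval, hpr,
            hM.parent (par u) hpr]
          tauto
    have f1 : ∀ y, y < 7 → (selectBody.run τ).ireg y = τ.ireg y := by
      intro y hy
      have h7 : y ≠ 7 := by omega
      have h8 : y ≠ 8 := by omega
      have h9 : y ≠ 9 := by omega
      rw [hrun]; split_ifs <;> simp [h7, h8, h9]
    have f2 : (selectBody.run τ).iarr = τ.iarr := by rw [hrun]; split_ifs <;> simp
    have f3 : (selectBody.run τ).warr = τ.warr := by rw [hrun]; split_ifs <;> simp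
    refine ⟨by rw [f1 5 (by norm_num), hI.counter], by simp, ?_, ?_, ?_, ?_, ?_⟩
    · simp [f1, hI.bound]
    · intro y hy
      have h5 : y ≠ 5 := by omega
      simp [h5, f1 y (by omega), hI.regs y hy]
    · simp [f2, hI.iarr]
    · simp [f3, hI.warr]
    · rw [hrun]
      by_cases hc : RunTop G r par l u ∧ σ.iarr 7 u = 0
      · simp only [hc, and_self, if_true]
        exact Or.inr ⟨u, by simp, hc.1, hc.2⟩
      · simp only [hc, if_false]
        rcases hI.found with ⟨h7, hall⟩ | ⟨c, h7, hc1, hc2⟩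
        · refine Or.inl ⟨by simp [h7], ?_⟩
          rintro c ⟨i, h1, h2, h3⟩ hct hc0
          rcases Nat.lt_succ_iff_lt_or_eq.1 h2 with h | rfl
          · exact hall c ⟨i, h1, h, h3⟩ hct hc0
          · obtain rfl : c = u := Fin.ext (h3.symm.trans hu)
            exact hc ⟨hct, hc0⟩
        · exact Or.inr ⟨c, by simp [h7], hc1, hc2⟩
  · refine ⟨by simp, by simp, ?_, by simp, by simp, Or.inl ⟨by simp, ?_⟩⟩
    · intro y hy
      simp [show y ≠ 5 by omega, show y ≠ 6 by omega, show y ≠ 7 by omega]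
    · rintro z ⟨i, hi1, hi2, _⟩
      omega

end SelectionPhase

/-! ### Inserting the selected leaves -/

section InsertionPhase

variable {n : ℕ} {G : SimpleGraph (Fin n)} {wt : Fin n → ℝ} {r : Fin n} {par par' : Fin n → Fin n}
  {κ : Fin n → Option (Fin n)} {X : Set (Fin n)} {off adj : ℕ → ℕ}

/-- Insert the leaf in register `2` into the edge above the vertex in register `7`, if this is
worthwhile. -/
def insertStep : Program :=
  .cond (.ilt (.reg 7) (.reg 0))
    (.seq (.seq (.istore 7 (.reg 7) (.const 1)) (.iset 9 (.pred (.arr 4 (.reg 2)))))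
      (.cond
        (.neg (.conj (.neg (.ilt (.succ (.arr 8 (.reg 9))) (.arr 5 (.reg 9))))
          (.neg (.wlt (.arr 1 (.reg 9)) (.arr 1 (.reg 2))))))
        (.seq (.istore 8 (.reg 9) (.succ (.arr 8 (.reg 9))))
          (.seq (.istore 9 (.reg 2) (.pred (.arr 4 (.reg 7)))) (.istore 9 (.reg 7) (.reg 2))))
        .skip))
    .skip

def leafBody : Program :=
  .cond (.ieq (.arr 5 (.reg 2)) (.const 0))
    (.seq (scan 2 markBody) (.seq selectEdge insertStep)) .skip

def leafPhase : Program := .seq (.iset 2 (.const 0)) (forLoop 2 0 leafBody)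

/-- The memory represents a selection: index array `7` marks the used edges, array `8` counts the
inserted children, array `9` holds the new parents. -/
structure SelectMem (off adj : ℕ → ℕ) (wt : Fin n → ℝ) (r : Fin n) (par : Fin n → Fin n)
    (κ : Fin n → Option (Fin n)) (X : Set (Fin n)) (par' : Fin n → Fin n) (σ : Mem) : Prop where
  tree : TreeMem off adj wt r par σ
  used : ∀ c : Fin n, σ.iarr 7 c = 0 ↔ ∀ l, κ l ≠ some c
  inserted : ∀ q : Fin n, σ.iarr 8 q = {u | u ∈ X ∧ par u = q}.ncard
  out_parent : ∀ v : Fin n, v ≠ r → σ.iarr 9 v = par' v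

lemma SelectMem.of_eq {σ τ : Mem} (h : SelectMem off adj wt r par κ X par' σ)
    (hreg : ∀ y, y < 5 → y ≠ 2 → τ.ireg y = σ.ireg y) (harr : ∀ a, a ≠ 6 → τ.iarr a = σ.iarr a)
    (hw : τ.warr = σ.warr) : SelectMem off adj wt r par κ X par' τ where
  tree := h.tree.of_eq hreg (fun a ha => harr a (by omega)) hw
  used := by rw [harr 7 (by norm_num)]; exact h.used
  inserted := by rw [harr 8 (by norm_num)]; exact h.inserted
  out_parent := by rw [harr 9 (by norm_num)]; exact h.out_parent

/-- Otherwise all children of `q` lie in `X` together with `l`, which is one element too few. -/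
lemma exists_other_child {l q : Fin n}
    (h : {u | u ∈ X ∧ par u = q}.ncard + 1 < {u | u ≠ r ∧ par u = q}.ncard) :
    ∃ u, u ≠ r ∧ par u = q ∧ u ≠ l ∧ u ∉ X := by
  by_contra hcon
  push Not at hcon
  have hsub : {u | u ≠ r ∧ par u = q} ⊆ insert l {u | u ∈ X ∧ par u = q} := by
    rintro u ⟨hu, huq⟩
    by_cases hul : u = l
    · exact Or.inl hul
    · exact Or.inr ⟨hcon u hu huq hul, huq⟩
  have h1 := Set.ncard_le_ncard hsub (Set.toFinite _)
  have h2 := Set.ncard_insert_le l {u | u ∈ X ∧ par u = q}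
  omega

/-- Otherwise `l` and `u` are two children outside `X`, and the count of children is too large. -/
lemma other_children_mem {l q : Fin n}
    (h : ¬ {u | u ∈ X ∧ par u = q}.ncard + 1 < {u | u ≠ r ∧ par u = q}.ncard)
    (hX : ∀ u ∈ X, u ≠ r) (hl : l ≠ r) (hlq : par l = q) (hlX : l ∉ X) {u : Fin n}
    (hu : u ≠ r) (huq : par u = q) (hul : u ≠ l) : u ∈ X := by
  by_contra huX
  have hsub : insert l (insert u {u | u ∈ X ∧ par u = q}) ⊆ {u | u ≠ r ∧ par u = q} := by
    rintro v (rfl | rfl | ⟨hv, hvq⟩)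
    · exact ⟨hl, hlq⟩
    · exact ⟨hu, huq⟩
    · exact ⟨hX v hv, hvq⟩
  have h1 := Set.ncard_le_ncard hsub (Set.toFinite _)
  rw [Set.ncard_insert_of_notMem, Set.ncard_insert_of_notMem] at h1
  · omega
  · exact fun h => huX h.1
  · rintro (h | h)
    · exact hul h.symm
    · exact hlX h.1

lemma ncard_inserted {l : Fin n} (hlX : l ∉ X) (q : Fin n) :
    {u | u ∈ insert l X ∧ par u = q}.ncard =
      {u | u ∈ X ∧ par u = q}.ncard + if q = par l then 1 else 0 := by
  split_ifs with hq
  · rw [← Set.ncard_insert_of_notMem (a := l) (s := {u | u ∈ X ∧ par u = q}) fun h => hlX h.1]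
    congr 1
    ext u
    simp only [Set.mem_insert_iff, Set.mem_ofPred_eq]
    constructor
    · rintro ⟨rfl | h, h2⟩
      · exact Or.inl rfl
      · exact Or.inr ⟨h, h2⟩
    · rintro (rfl | h)
      · exact ⟨Or.inl rfl, hq.symm⟩
      · exact ⟨Or.inr h.1, h.2⟩
  · rw [add_zero]
    congr 1
    ext u
    simp only [Set.mem_insert_iff, Set.mem_ofPred_eq]
    constructor
    · rintro ⟨rfl | h, h2⟩
      · exact absurd h2.symm hq
      · exact ⟨h, h2⟩
    · rintro ⟨h, h2⟩
      exact ⟨Or.inr h, h2⟩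

lemma insertStep_spec (T : SearchTree G wt r par) {l c : Fin n} {σ : Mem}
    (hleaf : IsLeaf r par l) (S : PartialSelection G wt r par l κ X)
    (P : Inserted par κ X par') (hM : SelectMem off adj wt r par κ X par' σ)
    (h2 : σ.ireg 2 = l) (h7 : σ.ireg 7 = c) (hc : RunTop G r par l c) (hc0 : σ.iarr 7 c = 0) :
    (∀ y, y < 5 → (insertStep.run σ).ireg y = σ.ireg y) ∧
      (insertStep.run σ).iarr 6 = σ.iarr 6 ∧
      ∃ κ' Y par'', PartialSelection G wt r par (l + 1) κ' Y ∧ Inserted par κ' Y par'' ∧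
        SelectMem off adj wt r par κ' Y par'' (insertStep.run σ) := by
  have hval : ∀ a b : Fin n, ((a : ℕ) = b) ↔ a = b := fun a b => Fin.ext_iff.symm
  have hfree := (hM.used c).1 hc0
  have hguard := T.guards_of_runTop hleaf hc
  have hlr := hguard.ne_root
  have hκl := S.eq_none rfl
  have hmemX : ∀ u ∈ X, IsLeaf r par u ∧ u ≠ r := by
    intro u hu
    obtain ⟨b, hb⟩ := S.chosen u hu
    exact ⟨S.leaf u b hb, (T.guards_of_runTop (S.leaf u b hb) (S.runTop u b hb)).ne_root⟩
  have hlX : l ∉ X := by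
    intro h
    obtain ⟨b, hb⟩ := S.chosen l h
    rw [hκl] at hb
    cases hb
  have hcX : c ∉ X := fun h => hguard.not_isLeaf (hmemX c h).1
  have hκ' : ∀ m, κ m ≠ some l := fun m hm =>
    (T.guards_of_runTop (S.leaf m l hm) (S.runTop m l hm)).not_isLeaf hleaf
  have hused : ∀ b : Fin n, (if (b : ℕ) = c then 1 else σ.iarr 7 b) = 0 ↔
      ∀ m, Function.update κ l (some c) m ≠ some b := by
    intro b
    simp only [hval]
    split_ifs with hb
    · subst hb
      simp only [false_iff, not_forall, not_not]
      exact ⟨l, Function.update_self _ _ _⟩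
    · rw [hM.used]
      refine forall_congr' fun m => ?_
      by_cases hm : m = l
      · subst hm
        simp [hκl, Ne.symm hb]
      · rw [Function.update_of_ne hm]
  -- The test of the program as a disjunction. Its first half says that the parent retains another
  -- child not inserted so far; its negation supplies the condition for a kept leaf.
  set t : Prop :=
    {u | u ∈ X ∧ par u = par l}.ncard + 1 < {u | u ≠ r ∧ par u = par l}.ncard ∨ wt (par l) < wt l
    with ht
  have hrun : insertStep.run σ = by
      classical exact if t then
        ((((σ.istore 7 c 1).iset 9 (par l)).istore 8 (par l)
          ({u | u ∈ X ∧ par u = par l}.ncard + 1)).istore 9 l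
          (par c)).istore 9 c l
        else (σ.istore 7 c 1).iset 9 (par l) := by
    classical
    have hcn : (c : ℕ) < n := c.2
    have hpl := hM.tree.parent l hlr
    have hpc := hM.tree.parent c hc.1
    simp only [insertStep, Program.run, IExp.eval, Test.Holds, h7, hM.tree.size, hcn, if_true,
      h2, Mem.istore_iarr_of_ne _ 7 _ _ 4 (by norm_num), Mem.istore_ireg, hpl,
      Nat.add_sub_cancel]
    refine if_congr ?_ ?_ rfl
    · simp [WExp.eval, IExp.eval, h2, hM.inserted, hM.tree.children, hM.tree.weight, ht]
      rw [← not_lt]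
      exact or_iff_not_imp_left.symm
    · simp [h2, h7, hpc, hM.inserted]
  have g1 : ∀ y, y < 5 → (insertStep.run σ).ireg y = σ.ireg y := by
    intro y hy
    have h9 : y ≠ 9 := by omega
    rw [hrun]; split_ifs <;> simp [h9]
  have g2 : (insertStep.run σ).iarr 6 = σ.iarr 6 := by
    rw [hrun]; split_ifs <;> simp
  have g3 : ∀ a, a < 6 → (insertStep.run σ).iarr a = σ.iarr a := by
    intro a ha
    rw [hrun]
    split_ifs <;> simp [show a ≠ 7 by omega, show a ≠ 8 by omega, show a ≠ 9 by omega]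
  have g4 : (insertStep.run σ).warr = σ.warr := by
    rw [hrun]; split_ifs <;> simp
  have htree : TreeMem off adj wt r par (insertStep.run σ) :=
    hM.tree.of_eq (fun y hy _ => g1 y hy) g3 g4
  refine ⟨g1, g2, ?_⟩
  by_cases htt : t
  · refine ⟨_, _, _, S.insert rfl hleaf hc hfree hlr ?_,
      P.insert hlX hguard.2.1.symm hcX hκ' hfree, htree, ?_, ?_, ?_⟩
    · rcases htt with h | h
      · exact Or.inl (exists_other_child h)
      · exact Or.inr h.le
    · intro b
      rw [hrun, if_pos htt, ← hused]
      simp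
    · intro v
      rw [hrun, if_pos htt, ncard_inserted hlX]
      simp only [Mem.istore_iarr_of_ne _ 9 _ _ 8 (by norm_num), Mem.istore_iarr_self, hval,
        Mem.iset_iarr, Mem.istore_iarr_of_ne _ 7 _ _ 8 (by norm_num), hM.inserted]
      by_cases hv : v = par l
      · simp [hv]
      · simp [hv]
    · intro v hv
      rw [hrun, if_pos htt]
      simp only [Mem.istore_iarr_self, hval, Function.update_apply]
      split_ifs
      · rfl
      · rfl
      · simpa using hM.out_parent v hv
  · refine ⟨_, _, _, S.keep rfl hleaf hc hfree ?_, P.keep hlX, htree, ?_, ?_, ?_⟩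
    · simp only [ht, not_or, not_lt] at htt
      refine ⟨htt.2, fun u hu huq hul => ?_⟩
      exact other_children_mem (not_lt.2 htt.1) (fun u hu => (hmemX u hu).2) hlr rfl hlX hu
        huq hul
    · intro b
      rw [hrun, if_neg htt, ← hused]
      simp
    · intro v
      rw [hrun, if_neg htt]
      simpa using hM.inserted v
    · intro v hv
      rw [hrun, if_neg htt]
      simpa using hM.out_parent v hv

/-- Invariant of the loop over the leaves. -/
structure LeafInv (G : SimpleGraph (Fin n)) (off adj : ℕ → ℕ) (wt : Fin n → ℝ) (r : Fin n)
    (par : Fin n → Fin n) (k : ℕ) (σ : Mem) : Prop where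
  counter : σ.ireg 2 = k
  marks : ∀ z : Fin n, σ.iarr 6 z ≤ k
  dummy : σ.iarr 6 n = 0
  selection : ∃ κ X par', PartialSelection G wt r par k κ X ∧ Inserted par κ X par' ∧
    SelectMem off adj wt r par κ X par' σ

/-- Upper bound for the number of steps of one iteration of the loop over the leaves. -/
def leafCost (off : ℕ → ℕ) (k : ℕ) : ℕ :=
  4 + ((off (k + 1) - off k) * (markBody.maxCost + 6) + 10 +
    ((off (k + 1) - off k) * (selectBody.maxCost + 6) + 12 + insertStep.maxCost))

lemma LeafInv.of_eq {k : ℕ} {σ τ : Mem}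
    (hM : ∃ κ X par', PartialSelection G wt r par (k + 1) κ X ∧ Inserted par κ X par' ∧
      SelectMem off adj wt r par κ X par' σ)
    (hmarks : ∀ z : Fin n, σ.iarr 6 z ≤ k + 1) (hdummy : σ.iarr 6 n = 0)
    (hreg : ∀ y, y < 5 → y ≠ 2 → τ.ireg y = σ.ireg y) (harr : τ.iarr = σ.iarr)
    (hw : τ.warr = σ.warr) (h2 : τ.ireg 2 = k) :
    τ.ireg 2 = k ∧ LeafInv G off adj wt r par (k + 1) (τ.iset 2 (k + 1)) := by
  obtain ⟨κ, X, par', S, P, hM⟩ := hM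
  refine ⟨h2, by simp, by simpa [harr] using hmarks, by simpa [harr] using hdummy, κ, X, par', S, P,
    hM.of_eq (fun y hy hy2 => ?_) (fun a _ => by simp [harr]) (by simp [hw])⟩
  simp [hy2, hreg y hy hy2]

lemma leafBody_runs (hA : IsAdjacencyArray G off adj) (T : SearchTree G wt r par) {k : ℕ}
    {σ : Mem} (hk : k < n) (hI : LeafInv G off adj wt r par k σ) :
    Runs leafBody σ (leafCost off k) fun τ => τ.ireg 2 = k ∧
      LeafInv G off adj wt r par (k + 1) (τ.iset 2 (k + 1)) := by
  obtain ⟨κ, X, par', S, P, hM⟩ := hI.selection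
  set l : Fin n := ⟨k, hk⟩ with hl
  have hlk : (l : ℕ) = k := rfl
  refine Runs.cond (t := .ieq (.arr 5 (.reg 2)) (.const 0)) (fun ht => ?_) fun ht => ?_
  · have hleaf : IsLeaf r par l := by
      rw [← hM.tree.isLeaf_iff]
      simpa [Test.Holds, IExp.eval, hI.counter] using ht
    refine (mark_runs (l := l) hA hM.tree hI.counter hI.marks hI.dummy).seq fun τ hτ => ?_
    have hMτ : SelectMem off adj wt r par κ X par' τ :=
      hM.of_eq (fun y hy _ => hτ.regs y hy) hτ.arrays hτ.warr
    have hτ2 : τ.ireg 2 = l := by rw [hτ.regs 2 (by norm_num), hI.counter]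
    refine (selectEdge_runs hA T hleaf hMτ.tree hτ2
      (fun z => (hτ.marked z).trans (hA.adj_iff l z).symm) hτ.dummy).seq fun υ hυ => ?_
    refine Runs.of_loopFree (by simp [insertStep, Program.LoopFree]) le_rfl ?_
    have hMυ : SelectMem off adj wt r par κ X par' υ :=
      hMτ.of_eq (fun y hy _ => hυ.regs y hy) (fun a _ => by rw [hυ.iarr]) hυ.warr
    have hυ2 : υ.ireg 2 = l := by rw [hυ.regs 2 (by norm_num), hτ2]
    have hυ6 : ∀ z : Fin n, υ.iarr 6 z ≤ k + 1 := by rw [hυ.iarr]; exact hτ.le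
    have hυn : υ.iarr 6 n = 0 := by rw [hυ.iarr]; exact hτ.dummy
    rcases hυ.found with ⟨h7, hnone⟩ | ⟨c, h7, hc, hc0⟩
    · have hrun : insertStep.run υ = υ := by
        simp [insertStep, Program.run, Test.Holds, IExp.eval, h7, hMυ.tree.size]
      rw [hrun]
      refine LeafInv.of_eq ⟨κ, X, par', S.skip hlk fun _ c hc => ?_, P, hMυ⟩ hυ6 hυn
        (fun _ _ _ => rfl) rfl rfl hυ2
      -- A run top is a neighbour of `l`, so the scan has seen it; an unused one would have been
      -- found.
      by_contra hcon
      push Not at hcon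
      exact hnone c ((hA.adj_iff l c).1 hc.2.1) hc ((hMτ.used c).2 hcon)
    · obtain ⟨g1, g2, hsel⟩ := insertStep_spec T hleaf S P hMυ hυ2 h7 hc (by rw [hυ.iarr, hc0])
      exact LeafInv.of_eq hsel (by rw [g2]; exact hυ6) (by rw [g2]; exact hυn)
        (fun _ _ _ => rfl) rfl rfl (by rw [g1 2 (by norm_num), hυ2])
  · refine Runs.of_loopFree trivial ?_ ?_
    · simp only [Program.maxCost]
      omega
    · refine LeafInv.of_eq ⟨κ, X, par', S.skip hlk fun hleaf => ?_, P, hM⟩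
        (fun z => (hI.marks z).trans (Nat.le_succ k)) hI.dummy (fun _ _ _ => rfl) rfl rfl hI.counter
      rw [← hM.tree.isLeaf_iff] at hleaf
      exact absurd (by simpa [Test.Holds, IExp.eval, hI.counter] using hleaf) ht

lemma leafPhase_runs (hA : IsAdjacencyArray G off adj) (T : SearchTree G wt r par)
    {vis : Set (Fin n)} {σ : Mem} (hM : SearchMem off adj wt r [] vis (parentPairs r par) σ) :
    Runs leafPhase σ (∑ x : Fin n, (leafCost off x + 6) + 5) fun τ => ∃ κ X par',
      Selection G wt r par κ X ∧ Inserted par κ X par' ∧ SelectMem off adj wt r par κ X par' τ := by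
  have hset : Runs (.iset 2 (.const 0)) σ 2 fun τ => τ = σ.iset 2 0 :=
    Runs.of_loopFree trivial le_rfl (by simp [Program.run, IExp.eval])
  refine (hset.seq (c := ∑ x : Fin n, (leafCost off x + 6) + 3) ?_).mono (by omega) fun _ => id
  rintro _ rfl
  rw [Fin.sum_univ_eq_sum_range (fun k => leafCost off k + 6), Finset.range_eq_Ico]
  refine (Runs.forLoop (LeafInv G off adj wt r par) (leafCost off) (Nat.zero_le n) ?_ ?_ ?_).mono
    le_rfl ?_
  · rintro k τ hI
    obtain ⟨κ, X, par', -, -, hM⟩ := hI.selection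
    exact ⟨hI.counter, hM.tree.size⟩
  · exact fun k τ _ hk hI => leafBody_runs hA T hk hI
  · refine ⟨by simp, by simp [hM.marks], by simp [hM.marks], fun _ => none, ∅, par,
      PartialSelection.start, Inserted.start, ?_, by simp [hM.used], by simp [hM.inserted], ?_⟩
    · refine ⟨by simp [hM.size], by simp [hM.out], by simp [hM.root], by simp [hM.off_eq],
        by simp [hM.adj_eq], by simp [hM.weight], ?_, by simp [hM.root_parent], ?_⟩
      · intro v hv
        simpa using hM.parent (par v) v ⟨hv, rfl⟩
      · intro v
        simpa [parentPairs] using hM.children v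
    · intro v hv
      simpa using hM.out_parent (par v) v ⟨hv, rfl⟩
  · intro τ hI
    obtain ⟨κ, X, par', S, P, hM⟩ := hI.selection
    exact ⟨κ, X, par', S.toSelection, P, hM⟩

end InsertionPhase

/-! ### Output -/

section Output

variable {n : ℕ} {r : Fin n} {par' : Fin n → Fin n}

def outputBody : Program :=
  .cond (.ieq (.reg 2) (.reg 3)) .skip
    (.seq (.istore 2 (.reg 1) (.arr 9 (.reg 2)))
      (.seq (.istore 3 (.reg 1) (.reg 2)) (.iset 1 (.succ (.reg 1)))))

def outputPhase : Program := .seq (.iset 2 (.const 0)) (forLoop 2 0 outputBody)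

/-- The lower end identifies a list entry: array `3` matches the positions with the non-root
vertices below `k`. -/
structure OutputInv (r : Fin n) (par' : Fin n → Fin n) (k : ℕ) (σ : Mem) : Prop where
  counter : σ.ireg 2 = k
  size : σ.ireg 0 = n
  root : σ.ireg 3 = r
  parent : ∀ v : Fin n, v ≠ r → σ.iarr 9 v = par' v
  sound : ∀ i < σ.ireg 1, ∃ v : Fin n, (v : ℕ) < k ∧ v ≠ r ∧ σ.iarr 2 i = par' v ∧ σ.iarr 3 i = v
  complete : ∀ v : Fin n, (v : ℕ) < k → v ≠ r → ∃ i < σ.ireg 1, σ.iarr 3 i = v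
  inj : ∀ i < σ.ireg 1, ∀ j < σ.ireg 1, σ.iarr 3 i = σ.iarr 3 j → i = j

lemma outputPhase_runs {σ : Mem} (h0 : σ.ireg 0 = n) (h1 : σ.ireg 1 = 0) (h3 : σ.ireg 3 = r)
    (h9 : ∀ v : Fin n, v ≠ r → σ.iarr 9 v = par' v) :
    Runs outputPhase σ (n * (outputBody.maxCost + 6) + 5) (OutputInv r par' n) := by
  have hset : Runs (.iset 2 (.const 0)) σ 2 fun τ => τ = σ.iset 2 0 :=
    Runs.of_loopFree trivial le_rfl (by simp [Program.run, IExp.eval])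
  refine (hset.seq (c := n * (outputBody.maxCost + 6) + 3) ?_).mono (by omega) fun _ => id
  rintro _ rfl
  refine (Runs.forLoop (OutputInv r par') (fun _ => outputBody.maxCost) (Nat.zero_le n)
    (fun k τ h => ⟨h.counter, h.size⟩) ?_ ?_).mono (by simp) fun _ => id
  · intro k τ _ hk hI
    refine Runs.of_loopFree (by simp [outputBody, Program.LoopFree]) le_rfl ?_
    have hcase : ∀ v : Fin n, (v : ℕ) < k + 1 → (v : ℕ) < k ∨ v = ⟨k, hk⟩ := by
      intro v hv
      rcases Nat.lt_succ_iff_lt_or_eq.1 hv with h | h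
      · exact Or.inl h
      · exact Or.inr (Fin.ext h)
    by_cases hkr : (⟨k, hk⟩ : Fin n) = r
    · have hkr' : k = r := congrArg Fin.val hkr
      have hrun : outputBody.run τ = τ := by
        simp [outputBody, Program.run, Test.Holds, IExp.eval, hI.counter, hI.root, hkr']
      rw [hrun]
      refine ⟨hI.counter, by simp, by simp [hI.size], by simp [hI.root], by simpa using hI.parent,
        ?_, ?_, by simpa using hI.inj⟩
      · intro i hi
        obtain ⟨v, hv, h⟩ := hI.sound i (by simpa using hi)
        exact ⟨v, by omega, by simpa using h⟩
      · intro v hv hvr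
        rcases hcase v hv with h | h
        · simpa using hI.complete v h hvr
        · exact absurd (h.trans hkr) hvr
    · have hkr' : k ≠ r := fun h => hkr (Fin.ext h)
      have h9k : τ.iarr 9 k = par' ⟨k, hk⟩ := hI.parent ⟨k, hk⟩ hkr
      set m := τ.ireg 1 with hm
      have hrun : outputBody.run τ =
          ((τ.istore 2 m (par' ⟨k, hk⟩)).istore 3 m k).iset 1 (m + 1) := by
        simp [outputBody, Program.run, Test.Holds, IExp.eval, hI.counter, hI.root, hkr', h9k, hm]
      have hlt : ∀ i < m, τ.iarr 3 i < k := by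
        intro i hi
        obtain ⟨v, hv, -, -, h⟩ := hI.sound i hi
        omega
      rw [hrun]
      refine ⟨by simp [hI.counter], by simp, by simp [hI.size], by simp [hI.root],
        by simpa using hI.parent, ?_, ?_, ?_⟩
      · intro i hi
        have hi' : i < m + 1 := by simpa using hi
        rcases Nat.lt_succ_iff_lt_or_eq.1 hi' with h | rfl
        · obtain ⟨v, hv, hvr, hv2, hv3⟩ := hI.sound i h
          exact ⟨v, by omega, hvr, by simpa [h.ne] using hv2, by simpa [h.ne] using hv3⟩
        · exact ⟨⟨k, hk⟩, by simp, hkr, by simp, by simp⟩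
      · intro v hv hvr
        rcases hcase v hv with h | rfl
        · obtain ⟨i, hi, hiv⟩ := hI.complete v h hvr
          have him : i < m := hi
          exact ⟨i, by simp; omega, by simpa [him.ne] using hiv⟩
        · exact ⟨m, by simp, by simp⟩
      · intro i hi j hj
        have hi' : i < m + 1 := by simpa using hi
        have hj' : j < m + 1 := by simpa using hj
        simp only [Mem.iset_iarr, Mem.istore_iarr_self]
        rcases Nat.lt_succ_iff_lt_or_eq.1 hi' with h | rfl <;>
          rcases Nat.lt_succ_iff_lt_or_eq.1 hj' with h' | h'
        · simpa [h.ne, h'.ne] using hI.inj i h j h'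
        · have := hlt i h
          simp [h.ne, h']
          omega
        · have := hlt j h'
          simp [h'.ne]
          omega
        · simp [h']
  · exact ⟨by simp, by simp [h0], by simp [h3], by simpa using h9, by simp [h1], by simp,
      by simp [h1]⟩

lemma OutputInv.holdsEdgeList {σ : Mem} (h : OutputInv r par' n σ) {d : Fin n → ℕ}
    (hd : ∀ v, v ≠ r → d (par' v) < d v) : HoldsEdgeList σ (parentGraph r par') where
  sound i hi := by
    obtain ⟨v, -, hvr, h2, h3⟩ := h.sound i hi
    exact ⟨par' v, v, parentGraph_adj_par hd hvr, h2, h3⟩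
  complete := by
    have key : ∀ v : Fin n, v ≠ r → ∃! i, i < σ.ireg 1 ∧
        s(σ.iarr 2 i, σ.iarr 3 i) = s((par' v : ℕ), (v : ℕ)) := by
      intro v hvr
      obtain ⟨i, hi, hiv⟩ := h.complete v v.2 hvr
      have hi2 : σ.iarr 2 i = par' v := by
        obtain ⟨u, -, -, h2, h3⟩ := h.sound i hi
        obtain rfl : u = v := Fin.ext (h3.symm.trans hiv)
        exact h2
      refine ⟨i, ⟨hi, by rw [hi2, hiv]⟩, ?_⟩
      rintro j ⟨hj, hjv⟩
      obtain ⟨u, -, hur, h2, h3⟩ := h.sound j hj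
      rw [h2, h3] at hjv
      have : s(par' u, u) = s(par' v, v) := by
        apply Sym2.map.injective Fin.val_injective
        simpa using hjv
      obtain rfl := par_edge_injOn hd hur hvr this
      exact h.inj j hj i hi (h3.trans hiv.symm)
    intro u v huv
    rcases ((SimpleGraph.fromRel_adj _ _ _).1 huv).2 with ⟨h1, h2⟩ | ⟨h1, h2⟩
    · rw [← h2]; exact key v h1
    · rw [← h2, Sym2.eq_swap]; exact key u h1

end Output

/-! ### The algorithm -/

/-- Greedy depth-first search followed by the insertion of leaves into tree edges. -/
def treeProgram : Program :=
  .seq weightPhase (.seq searchPhase (.seq leafPhase outputPhase))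

/-- The factor in the running time of `treeProgram`. -/
def treeConstant : ℕ :=
  (weightBody.maxCost + 6) + 3 * (15 + moveStep.maxCost) + 6 * (bestBody.maxCost + 6) +
    (32 + insertStep.maxCost) + 2 * (markBody.maxCost + 6 + (selectBody.maxCost + 6)) +
    (outputBody.maxCost + 6) + 24

section Main

variable {n : ℕ} {G : SimpleGraph (Fin n)} {w : Fin n → ℝ} {off adj : ℕ → ℕ}

lemma sum_visit_arith (D : Fin n → ℕ) (b c : ℕ) :
    ∑ x, (3 + (D x * c + 12 + b)) = n * (15 + b) + (∑ x, D x) * c := by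
  simp only [Finset.sum_add_distrib, ← Finset.sum_mul, Finset.sum_const, Finset.card_univ,
    Fintype.card_fin, smul_eq_mul]
  ring

lemma sum_leaf_arith (D : Fin n → ℕ) (d e f : ℕ) :
    ∑ x, (4 + (D x * e + 10 + (D x * f + 12 + d)) + 6) = n * (32 + d) + (∑ x, D x) * (e + f) := by
  simp only [Finset.sum_add_distrib, ← Finset.sum_mul, Finset.sum_const, Finset.card_univ,
    Fintype.card_fin, smul_eq_mul]
  ring

/-- The additive constants `3 + 11 + 5 + 5` are absorbed by `24 * n`; the terms `2 * m` are degree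
sums. -/
lemma time_arith {n m a b c d e f : ℕ} (hn : 0 < n) :
    n * a + 3 + (3 * (n * b + 2 * m * c) + 11 + (n * d + 2 * m * e + 5 + (n * f + 5))) ≤
      (a + 3 * b + 6 * c + d + 2 * e + f + 24) * (n + m) := by
  have h : (a + 3 * b + 6 * c + d + 2 * e + f + 24) * (n + m) =
      n * a + 3 * (n * b + 2 * m * c) + (n * d + 2 * m * e) + n * f + 24 * n +
      ((6 * c + 2 * e) * n + (a + 3 * b + d + f + 24) * m) := by ring
  rw [h]
  have := Nat.zero_le ((6 * c + 2 * e) * n + (a + 3 * b + d + f + 24) * m)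
  linarith

open Classical in
lemma IsAdjacencyArray.time_le (hA : IsAdjacencyArray G off adj) (hn : 0 < n) :
    n * (weightBody.maxCost + 6) + 3 + (3 * ∑ x : Fin n, visitCost off x + 11 +
      (∑ x : Fin n, (leafCost off x + 6) + 5 + (n * (outputBody.maxCost + 6) + 5))) ≤
    treeConstant * (n + G.edgeFinset.card) := by
  have hsum : ∑ x : Fin n, (off (x + 1) - off x) = 2 * G.edgeFinset.card := by
    rw [← G.sum_degrees_eq_twice_card_edges]
    exact Finset.sum_congr rfl fun x _ => hA.degree_eq x
  have h1 : ∑ x : Fin n, visitCost off x =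
      n * (15 + moveStep.maxCost) + 2 * G.edgeFinset.card * (bestBody.maxCost + 6) := by
    rw [← hsum]
    exact sum_visit_arith _ _ _
  have h2 : ∑ x : Fin n, (leafCost off x + 6) = n * (32 + insertStep.maxCost) +
      2 * G.edgeFinset.card * (markBody.maxCost + 6 + (selectBody.maxCost + 6)) := by
    rw [← hsum]
    exact sum_leaf_arith _ _ _ _
  rw [h1, h2]
  exact time_arith hn

open Classical in
/-- What `treeProgram` computes. -/
lemma treeProgram_runs (hG : G.Connected) (hclaw : ClawFree G) (hdeg : ∀ v, G.degree v ≠ 2)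
    (hw : ∀ v, 0 ≤ w v) (hA : IsAdjacencyArray G off adj) :
    Runs treeProgram (inputMem off adj w) (treeConstant * (n + G.edgeFinset.card)) fun σ =>
      ∃ (T : SimpleGraph (Fin n)) (r : Fin n), HoldsEdgeList σ T ∧ IsSpanningTree G T ∧
        (∀ v, innerWeight G w r ≤ innerWeight G w v) ∧
        3 / 5 * (∑ v, innerWeight G w v - innerWeight G w r) ≤ internalWeight T w := by
  have hn : 0 < n := by
    obtain ⟨v⟩ := hG.nonempty
    exact v.pos
  refine Runs.mono ?_ (hA.time_le hn) fun _ => id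
  refine (weightPhase_runs hA w).seq fun σ hσ => ?_
  obtain ⟨h0, -⟩ | ⟨r, -, hr, hmin⟩ := hσ.root
  · omega
  refine (searchPhase_runs hclaw hA hσ hr).seq ?_
  rintro τ ⟨vis, E, hD, hM⟩
  obtain ⟨par, rfl, T⟩ := hD.inv.exists_searchTree hG
  refine (leafPhase_runs hA T hM).seq ?_
  rintro υ ⟨κ, X, par', S, P, hMυ⟩
  obtain ⟨d, hd⟩ := P.rank T S
  refine (outputPhase_runs hMυ.tree.size hMυ.tree.out hMυ.tree.root hMυ.out_parent).mono le_rfl ?_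
  intro φ hφ
  have hiw0 : ∀ v, 0 ≤ innerWeight G w v := by
    intro v
    rw [innerWeight]
    split_ifs
    · exact le_rfl
    · exact hw v
  have hiw : ∀ v, innerWeight G w v ≤ w v := by
    intro v
    rw [innerWeight]
    split_ifs
    · exact hw v
    · exact le_rfl
  refine ⟨parentGraph r par', r, hφ.holdsEdgeList hd, ⟨?_, parentGraph_isTree hd⟩,
    fun v => hmin v v.2, ?_⟩
  · intro u v huv
    rcases ((SimpleGraph.fromRel_adj _ _ _).1 huv).2 with ⟨h1, h2⟩ | ⟨h1, h2⟩
    · rw [← h2]; exact P.adj T S h1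
    · rw [← h2]; exact (P.adj T S h1).symm
  · refine (P.internal_weight hclaw T S hiw0 ?_
      (Finset.univ.filter fun v => 2 ≤ (parentGraph r par').degree v) ?_).trans ?_
    -- Non-zero inner weight excludes degree one, the tree edge above `v` degree zero, and the
    -- hypothesis degree two; so two neighbours remain after discarding `p`.
    · intro v hvr hv p
      have h1 : G.degree v ≠ 1 := fun h => hv (by rw [innerWeight, if_pos h])
      have h0 : 0 < G.degree v := by
        rw [SimpleGraph.degree_pos_iff_exists_adj]
        exact ⟨par v, (T.adj v hvr).symm⟩
      have h3 : 1 < ((G.neighborFinset v).erase p).card := by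
        have := Finset.pred_card_le_card_erase (s := G.neighborFinset v) (a := p)
        rw [SimpleGraph.card_neighborFinset_eq_degree] at this
        have := hdeg v
        omega
      obtain ⟨a, ha, b, hb, hab⟩ := Finset.one_lt_card.1 h3
      simp only [Finset.mem_erase, SimpleGraph.mem_neighborFinset] at ha hb
      exact ⟨a, b, hab, ha.1, hb.1, ha.2, hb.2⟩
    · exact fun u hu hur =>
        Finset.mem_filter.2 ⟨Finset.mem_univ _, two_le_degree_parentGraph hd hur hu rfl⟩
    · exact Finset.sum_le_sum fun v _ => hiw v

-- A tree with `n` vertices has degree sum `2n - 2 < 2n`. The vertex found is what any competing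
-- spanning tree loses, to be weighed against the uncounted root.
open Classical in
lemma exists_degree_lt_two {V : Type*} [Fintype V] {S : SimpleGraph V} (hS : S.IsTree) :
    ∃ v, S.degree v < 2 := by
  by_contra hcon
  push Not at hcon
  have h1 := S.sum_degrees_eq_twice_card_edges
  have h2 := hS.card_edgeFinset
  have h3 : Fintype.card V * 2 ≤ ∑ v, S.degree v := by
    simpa using Finset.card_nsmul_le_sum Finset.univ (fun v => S.degree v) 2 fun v _ => hcon v
  omega

open Classical in
/-- The internal weight of a spanning tree is at most the total inner weight minus the minimum
inner weight. -/
lemma internalWeight_le (hw : ∀ v, 0 ≤ w v) {S : SimpleGraph (Fin n)} (hS : IsSpanningTree G S)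
    {r : Fin n} (hr : ∀ v, innerWeight G w r ≤ innerWeight G w v) :
    internalWeight S w ≤ ∑ v, innerWeight G w v - innerWeight G w r := by
  obtain ⟨v₀, hv₀⟩ := exists_degree_lt_two hS.2
  have h1 : internalWeight S w ≤ ∑ v ∈ Finset.univ.erase v₀, innerWeight G w v := by
    rw [internalWeight]
    calc _ = ∑ v with 2 ≤ S.degree v, innerWeight G w v := by
          refine Finset.sum_congr rfl fun v hv => ?_
          have h2 : 2 ≤ S.degree v := (Finset.mem_filter.1 hv).2
          have h3 : S.degree v ≤ G.degree v := SimpleGraph.degree_le_of_le hS.1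
          rw [innerWeight, if_neg (by omega)]
      _ ≤ _ := by
          refine Finset.sum_le_sum_of_subset_of_nonneg ?_ fun v _ _ => ?_
          · intro v hv
            refine Finset.mem_erase.2 ⟨?_, Finset.mem_univ v⟩
            rintro rfl
            have := (Finset.mem_filter.1 hv).2
            omega
          · rw [innerWeight]
            split_ifs
            · exact le_rfl
            · exact hw v
  rw [Finset.sum_erase_eq_sub (Finset.mem_univ v₀)] at h1
  linarith [hr v₀]

end Main

end MaxwIST

open Classical in
theorem mainTheorem2 :
    -- greedy DFS trees from a minimum-weight root exist and are binary
    (∀ (n : ℕ) (G : SimpleGraph (Fin n)) (w : Fin n → ℝ),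
      G.Connected → MaxwIST.ClawFree G → (∀ v, 3 ≤ G.degree v) → (∀ v, 0 ≤ w v) →
      ∀ r : Fin n, (∀ v, w r ≤ w v) →
        (∃ E, MaxwIST.IsGreedyDFSTree G w r E) ∧
        ∀ E, MaxwIST.IsGreedyDFSTree G w r E → MaxwIST.IsBinary E) ∧
    -- minimum degree at least three: ratio `3/5 - 1/n` to the total weight, in time `O(n + m)`
    (∃ (p : MaxwIST.Program) (C : ℕ),
      ∀ (n : ℕ) (G : SimpleGraph (Fin n)) (w : Fin n → ℝ),
      G.Connected → MaxwIST.ClawFree G → (∀ v, 3 ≤ G.degree v) → (∀ v, 0 ≤ w v) →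
        MaxwIST.OutputsSpanningTree p (C * (n + G.edgeFinset.card)) G w fun T =>
          (3 / 5 - 1 / (n : ℝ)) * ∑ v, w v ≤ MaxwIST.internalWeight T w) ∧
    -- no vertex of degree two: linear-time `(3/5 - ε)`-approximation
    (∀ ε : ℝ, 0 < ε → ∃ (p : MaxwIST.Program) (C : ℕ),
      ∀ (n : ℕ) (G : SimpleGraph (Fin n)) (w : Fin n → ℝ),
      G.Connected → MaxwIST.ClawFree G → (∀ v, G.degree v ≠ 2) → (∀ v, 0 ≤ w v) →
        MaxwIST.OutputsSpanningTree p (C * (n + G.edgeFinset.card)) G w fun T =>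
          ∀ S : SimpleGraph (Fin n), MaxwIST.IsSpanningTree G S →
            (3 / 5 - ε) * MaxwIST.internalWeight S w ≤ MaxwIST.internalWeight T w) := by
  refine ⟨?_, ⟨MaxwIST.treeProgram, MaxwIST.treeConstant, ?_⟩,
    fun ε hε => ⟨MaxwIST.treeProgram, MaxwIST.treeConstant, ?_⟩⟩
  · intro n G w _ hclaw _ _ r _
    exact ⟨MaxwIST.GreedyDFS.start.exists_complete, fun E ⟨_, hE⟩ => hE.inv.isBinary hclaw⟩
  · intro n G w hG hclaw hdeg hw off adj hA
    have hn : 0 < n := by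
      obtain ⟨v⟩ := hG.nonempty
      exact v.pos
    have hiw : MaxwIST.innerWeight G w = w := by
      funext v
      have := hdeg v
      rw [MaxwIST.innerWeight, if_neg (by omega)]
    obtain ⟨σ, t, h1, h2, T, r, h3, h4, hmin, h5⟩ :=
      MaxwIST.treeProgram_runs hG hclaw (fun v => by have := hdeg v; omega) hw hA
    refine ⟨σ, t, T, h1, h2, h3, h4, le_trans ?_ h5⟩
    rw [hiw] at hmin ⊢
    have hsum : (n : ℝ) * w r ≤ ∑ v, w v := by
      simpa using Finset.card_nsmul_le_sum Finset.univ w (w r) fun v _ => hmin v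
    have hn' : (0 : ℝ) < n := by exact_mod_cast hn
    -- The minimum is at most the average; only `3/5` of it is lost, so the loss `1/n` is generous.
    have hle : w r ≤ 1 / (n : ℝ) * ∑ v, w v := by
      rw [one_div, inv_mul_eq_div, le_div_iff₀ hn']
      linarith
    have := hw r
    linarith
  · intro n G w hG hclaw hdeg hw off adj hA
    obtain ⟨σ, t, h1, h2, T, r, h3, h4, hmin, h5⟩ :=
      MaxwIST.treeProgram_runs hG hclaw hdeg hw hA
    refine ⟨σ, t, T, h1, h2, h3, h4, fun S hS => ?_⟩
    have h6 := MaxwIST.internalWeight_le hw hS hmin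
    have h7 : 0 ≤ MaxwIST.internalWeight S w := Finset.sum_nonneg fun v _ => hw v
    -- The bound already holds with factor 3/5; `ε` only weakens it.
    have h8 := mul_nonneg hε.le h7
    linarith
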